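/- Let $T>0$, $\ell_0>0$, $0<c_1<c_2$, and let $\kappa:[0,\infty)\to[c_1,c_2]$ be locally Lipschitz. Consider the dynamic debonding problem for a front $\ell:[0,T]\to\mathbb{R}$ and a displacement $y$ on $\Omega_\ell:=\{(t,x): 0\le t\le T,\ 0\le x\le \ell(t)\}$: \[ \begin{cases} \partial_{tt}^2y-\partial_{xx}^2y=0, & 0<t<T,\ 0<x<\ell(t),\\ y(t,0)=u(t),\quad y(t,\ell(t))=0, & 0\le t\le T,\\ y(0,x)=y_0(x),\quad \partial_t y(0,x)=y_1(x), & 0\le x\le \ell_0, \end{cases} \] coupled with Griffith's criterion \[ \ell(0)=\ell_0,\qquad \ell'(t)\ge 0,\qquad G(t)\le\kappa(\ell(t)),\qquad \ell'(t)\,[G(t)-\kappa(\ell(t))]=0\quad(0<t\le T), \] where $G(t)=\tfrac12(1-\ell'(t)^2)\,(\partial_xy(t,\ell(t)))^2$. The wave equation is understood in the sense of distributions. For a $C^{0,1}$-solution, $\ell$ and $y$ are Lipschitz on $[0,T]$ and $\Omega_\ell$, and the initial velocity and Griffith's criterion hold (with the derivatives involved existing, one-sided at the boundary) almost everywhere;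 for a $C^1$-solution, $\ell\in C^1[0,T]$ and $y\in C^1(\Omega_\ell)$ up to the boundary, and these conditions hold at every point. Assume $y_0\in C^1[0,\ell_0]$, $y_1\in C^0[0,\ell_0]$, $u\in C^1[0,T]$, and the compatibility conditions \[ y_0(0)=u(0),\qquad y_0(\ell_0)=0,\qquad y_1(0)=u'(0), \] \[ y_1(\ell_0)=-\max\left[\frac{\frac12|y_1(\ell_0)-y_0'(\ell_0)|^2-\kappa(\ell_0)}{\frac12|y_1(\ell_0)-y_0'(\ell_0)|^2+\kappa(\ell_0)},\,0\right]y_0'(\ell_0). \] Then there exists a $C^1$-solution $(\ell,y)$ of this problem, and it is the unique solution, even among all $C^{0,1}$-solutions. Moreover, the representative function $f:[-\ell_0,T]\to\mathbb{R}$, which is uniquely determined by \[ \begin{cases} f(s)=\tfrac12\int_0^{-s}(y_0'-y_1)(\sigma)\,d\sigma, & s\in[-\ell_0,0],\\ f(s)=u(s)-u(0)-\tfrac12\int_0^{s}(y_0'+y_1)(\sigma)\,d\sigma, & s\in(0,\ell_0],\ s\le T,\\ f(t+\ell(t))=u(t+\ell(t))+f(t-\ell(t)), & t>0,\ t+\ell(t)\le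 T, \end{cases} \] belongs to $C^1[-\ell_0,T]$. -/

import Mathlib

open Set MeasureTheory
open scoped ContDiff

namespace Debonding

/-- The closed space-time domain `{(t, x) : 0 ≤ t ≤ T, 0 ≤ x ≤ ℓ t}`. -/
def domain (T : ℝ) (ℓ : ℝ → ℝ) : Set (ℝ × ℝ) :=
  {p | 0 ≤ p.1 ∧ p.1 ≤ T ∧ 0 ≤ p.2 ∧ p.2 ≤ ℓ p.1}

/-- The open space-time domain `{(t, x) : 0 < t < T, 0 < x < ℓ t}`. -/
def openDomain (T : ℝ) (ℓ : ℝ → ℝ) : Set (ℝ × ℝ) :=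
  {p | 0 < p.1 ∧ p.1 < T ∧ 0 < p.2 ∧ p.2 < ℓ p.1}

/-- `∂ₜₜ φ - ∂ₓₓ φ` at the point `p = (t, x)`. -/
noncomputable def waveOp (φ : ℝ × ℝ → ℝ) (p : ℝ × ℝ) : ℝ :=
  iteratedDeriv 2 (fun t => φ (t, p.2)) p.1 - iteratedDeriv 2 (fun x => φ (p.1, x)) p.2

/-- `y` satisfies `∂ₜₜ y - ∂ₓₓ y = 0` in the sense of distributions on the open domain. -/
def WeakWave (T : ℝ) (ℓ : ℝ → ℝ) (y : ℝ × ℝ → ℝ) : Prop :=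
  ∀ φ : ℝ × ℝ → ℝ, ContDiff ℝ ∞ φ → HasCompactSupport φ → tsupport φ ⊆ openDomain T ℓ →
    ∫ p : ℝ × ℝ, y p * waveOp φ p = 0

/-- The dynamic energy release rate at speed `v`, when `∂ₓ y (t, ℓ t) = q`. -/
noncomputable def energyRelease (v q : ℝ) : ℝ := 1 / 2 * (1 - v ^ 2) * q ^ 2

/-- Griffith's criterion at the time `t`: with `v = ℓ' t` and `q = ∂ₓ y (t, ℓ t)` (a one-sided
derivative, taken inside the domain), which are required to exist. -/
def GriffithAt (T : ℝ) (κ ℓ : ℝ → ℝ) (y : ℝ × ℝ → ℝ) (t : ℝ) : Prop :=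
  ∃ v q : ℝ, HasDerivWithinAt ℓ v (Icc 0 T) t ∧
    HasDerivWithinAt (fun x => y (t, x)) q (Icc 0 (ℓ t)) (ℓ t) ∧
    0 ≤ v ∧ energyRelease v q ≤ κ (ℓ t) ∧ v * (energyRelease v q - κ (ℓ t)) = 0

/-- Lipschitz (`C^{0,1}`) solutions `(ℓ, y)` on `[0, T]` of the debonding problem with toughness
`κ`, initial front `ℓ₀`, initial data `(y₀, y₁)` and boundary control `u`. The wave equation holds
in the sense of distributions, the initial velocity is attained and Griffith's criterion holds
almost everywhere. -/
structure IsLipschitzSolution (T : ℝ) (κ : ℝ → ℝ) (ℓ₀ : ℝ) (y₀ y₁ u : ℝ → ℝ)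
    (ℓ : ℝ → ℝ) (y : ℝ × ℝ → ℝ) : Prop where
  lipschitz_front : ∃ K, LipschitzOnWith K ℓ (Icc 0 T)
  lipschitz_displacement : ∃ K, LipschitzOnWith K y (domain T ℓ)
  wave : WeakWave T ℓ y
  left_boundary : ∀ t ∈ Icc 0 T, y (t, 0) = u t
  front_boundary : ∀ t ∈ Icc 0 T, y (t, ℓ t) = 0
  initial_displacement : ∀ x ∈ Icc 0 ℓ₀, y (0, x) = y₀ x
  initial_velocity_ae : ∀ᵐ x ∂(volume.restrict (Icc 0 ℓ₀)),
    HasDerivWithinAt (fun t => y (t, x)) (y₁ x) (Icc 0 T) 0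
  initial_front : ℓ 0 = ℓ₀
  griffith_ae : ∀ᵐ t ∂(volume.restrict (Icc 0 T)), GriffithAt T κ ℓ y t

/-- `C^1` solutions on `[0, T]`: `ℓ` and `y` are `C^1` up to the boundary of `[0, T]` and of the
closed space-time domain, and the initial velocity and Griffith's criterion hold at every point. -/
structure IsC1Solution (T : ℝ) (κ : ℝ → ℝ) (ℓ₀ : ℝ) (y₀ y₁ u : ℝ → ℝ)
    (ℓ : ℝ → ℝ) (y : ℝ × ℝ → ℝ) : Prop
    extends IsLipschitzSolution T κ ℓ₀ y₀ y₁ u ℓ y where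
  contDiff_front : ContDiffOn ℝ 1 ℓ (Icc 0 T)
  contDiff_displacement : ContDiffOn ℝ 1 y (domain T ℓ)
  initial_velocity : ∀ x ∈ Icc 0 ℓ₀,
    HasDerivWithinAt (fun t => y (t, x)) (y₁ x) (Icc 0 T) 0
  griffith : ∀ t ∈ Ioc 0 T, GriffithAt T κ ℓ y t

/-- `f` is the representative function on `[-ℓ₀, T]` of the solution with front `ℓ`. -/
structure IsRepresentative (T ℓ₀ : ℝ) (y₀ y₁ u ℓ f : ℝ → ℝ) : Prop where
  initial : ∀ s ∈ Icc (-ℓ₀) 0,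
    f s = 1 / 2 * ∫ σ in (0 : ℝ)..(-s), (derivWithin y₀ (Icc 0 ℓ₀) σ - y₁ σ)
  control : ∀ s ∈ Ioc 0 ℓ₀, s ≤ T →
    f s = u s - u 0 - 1 / 2 * ∫ σ in (0 : ℝ)..s, (derivWithin y₀ (Icc 0 ℓ₀) σ + y₁ σ)
  reflection : ∀ t, 0 < t → t + ℓ t ≤ T → t ≤ T →
    f (t + ℓ t) = u (t + ℓ t) + f (t - ℓ t)

/-- The front speed `max [(½ w² - k) / (½ w² + k), 0]` that Griffith's criterion prescribes for
`w = ∂ₜ y - ∂ₓ y` at the front and toughness `k`. -/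
noncomputable def frontSpeed (w k : ℝ) : ℝ :=
  max ((1 / 2 * |w| ^ 2 - k) / (1 / 2 * |w| ^ 2 + k)) 0

end Debonding

/-! Put `h = U - f`, with `U` a global extension of `u`. Then `f (t - x) + h (t + x)` solves the
wave equation and meets the left boundary condition, and it vanishes at the front exactly when `f (t
+ ℓ) = U (t + ℓ) + f (t - ℓ)`. Differentiating along the front gives `∂ₓ y = -2 f' (t - ℓ) / (1 +
ℓ')`, so Griffith's criterion determines `ℓ'` from `f' (t - ℓ)` and `κ ℓ`. As an equation in `t`
this depends on `ℓ` through the merely continuous `f'`. In the retarded time `σ = t - ℓ`, with `ℓ =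
lam σ`, it reads `lam' = max (f' σ ^ 2 / κ lam - 1 / 2) 0`, which is Lipschitz in the unknown for
every continuous `f'`. This is why `C^1` data suffice.

Existence: the data give `f` up to `ℓ₀`, and the reflection law expresses `f (σ + 2 lam σ)` through
`f σ`, so every reflection gains at least `2ℓ₀` (`exists_reflected_profile`). The two velocity
compatibility conditions are the matching of `f'` at `0` and at `ℓ₀` (`exists_initial_profile`).

Uniqueness: testing against `A (t - x) * B (t + x)` turns the distributional equation into the
parallelogram identity for any Lipschitz solution (`parallelogram_identity`); Griffith's criterion
makes its front nondecreasing and 1-Lipschitz, so characteristic rectangles fit below it. The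
initial data settle `t + x ≤ ℓ₀` (`eq_dAlembert_of_initial`). If the solution is known for `t + x ≤
B`, then `z - f (t - x)` depends on `t + x` alone for `t - x ≤ B`. Hence `f'` prescribes the front
speed almost everywhere while `t - m t < B`, and Grönwall puts the front on the curve `lam`
(`front_eq_frontCurve`). Reflections at the front and at `x = 0` then raise `B` by `ℓ₀`
(`front_and_displacement_unique`). -/

namespace Debonding

/-! ### One-variable calculus: extension, gluing, inversion, almost everywhere derivatives,
differential equations -/

/-- The primitive of a continuous function is continuously differentiable. -/
theorem hasDerivAt_const_add_integral {g : ℝ → ℝ} (hg : Continuous g) (c a x : ℝ) :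
    HasDerivAt (fun s => c + ∫ r in a..s, g r) (g x) x :=
  (intervalIntegral.integral_hasDerivAt_right (hg.intervalIntegrable _ _)
    hg.stronglyMeasurable.stronglyMeasurableAtFilter hg.continuousAt).const_add c

theorem contDiff_one_of_hasDerivAt {f f' : ℝ → ℝ} (h : ∀ x, HasDerivAt f (f' x) x)
    (hf' : Continuous f') : ContDiff ℝ 1 f := by
  rw [contDiff_one_iff_deriv]
  refine ⟨fun x => (h x).differentiableAt, ?_⟩
  have : deriv f = f' := funext fun x => (h x).deriv
  rwa [this]

theorem hasDerivAt_of_contDiff_one {f : ℝ → ℝ} (h : ContDiff ℝ 1 f) (x : ℝ) :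
    HasDerivAt f (deriv f x) x :=
  (h.differentiable one_ne_zero x).hasDerivAt

theorem continuous_deriv_of_contDiff_one {f : ℝ → ℝ} (h : ContDiff ℝ 1 f) :
    Continuous (deriv f) :=
  h.continuous_deriv le_rfl

/-- A continuous function on a compact interval, extended by its boundary values. -/
theorem exists_continuous_extension {g : ℝ → ℝ} {a b : ℝ} (hab : a ≤ b)
    (hg : ContinuousOn g (Icc a b)) : ∃ G : ℝ → ℝ, Continuous G ∧ EqOn G g (Icc a b) := by
  refine ⟨IccExtend hab ((Icc a b).domRestrict g), ?_, ?_⟩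
  · exact (continuousOn_iff_continuous_domRestrict.1 hg).Icc_extend'
  · intro x hx
    rw [IccExtend_of_mem hab _ hx]
    rfl

/-- A `C^1` function on a compact interval extends to a `C^1` function on the line. -/
theorem exists_contDiff_extension {g : ℝ → ℝ} {a b : ℝ} (hab : a < b)
    (hg : ContDiffOn ℝ 1 g (Icc a b)) : ∃ G : ℝ → ℝ, ContDiff ℝ 1 G ∧ EqOn G g (Icc a b) := by
  obtain ⟨D, hD, hDg⟩ := exists_continuous_extension hab.le
    (hg.continuousOn_derivWithin (uniqueDiffOn_Icc hab) le_rfl)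
  have hder := hasDerivAt_const_add_integral hD (g a) a
  refine ⟨fun s => g a + ∫ r in a..s, D r, contDiff_one_of_hasDerivAt hder hD, ?_⟩
  have hd : DifferentiableOn ℝ g (Icc a b) := hg.differentiableOn one_ne_zero
  intro x hx
  have := eq_of_derivWithin_eq (f := fun s => g a + ∫ r in a..s, D r) (g := g) (a := a) (b := b)
    (fun y _ => (hder y).differentiableAt.differentiableWithinAt) hd ?_ ?_ x hx
  · exact this
  · intro y hy
    rw [(hder y).hasDerivWithinAt.derivWithin
      (uniqueDiffOn_Icc hab y (Ico_subset_Icc_self hy)), hDg (Ico_subset_Icc_self hy)]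
  · simp

theorem deriv_eq_derivWithin_of_eqOn {G g : ℝ → ℝ} {a b : ℝ} (hab : a < b)
    (hG : ContDiff ℝ 1 G) (h : EqOn G g (Icc a b)) {x : ℝ} (hx : x ∈ Icc a b) :
    derivWithin g (Icc a b) x = deriv G x := by
  rw [← derivWithin_congr h (h hx)]
  exact (hasDerivAt_of_contDiff_one hG x).hasDerivWithinAt.derivWithin (uniqueDiffOn_Icc hab x hx)

/-- Two `C^1` functions that agree to first order at `c` can be glued there. -/
theorem contDiff_one_glue {f g : ℝ → ℝ} (hf : ContDiff ℝ 1 f) (hg : ContDiff ℝ 1 g) {c : ℝ}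
    (h0 : f c = g c) (h1 : deriv f c = deriv g c) :
    ContDiff ℝ 1 (fun s => if s ≤ c then f s else g s) := by
  have hcont : Continuous (fun s => if s ≤ c then deriv f s else deriv g s) :=
    Continuous.if_le (continuous_deriv_of_contDiff_one hf) (continuous_deriv_of_contDiff_one hg)
      continuous_id continuous_const (fun x hx => by rw [show x = c from hx, h1])
  refine contDiff_one_of_hasDerivAt (fun x => ?_) hcont
  rcases lt_trichotomy x c with hx | hx | hx
  · rw [if_pos hx.le]
    refine (hasDerivAt_of_contDiff_one hf x).congr_of_eventuallyEq ?_
    filter_upwards [Iio_mem_nhds hx] with y hy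
    exact if_pos (le_of_lt hy)
  · subst hx
    rw [if_pos le_rfl]
    rw [← hasDerivWithinAt_univ, ← Iic_union_Ici (a := x)]
    refine HasDerivWithinAt.union ?_ ?_
    · refine (hasDerivAt_of_contDiff_one hf x).hasDerivWithinAt.congr (fun y hy => if_pos hy)
        (if_pos le_rfl)
    · rw [h1]
      refine (hasDerivAt_of_contDiff_one hg x).hasDerivWithinAt.congr (fun y hy => ?_) ?_
      · split_ifs with h
        · rw [le_antisymm h hy, h0]
        · rfl
      · rw [if_pos le_rfl, h0]
  · rw [if_neg (not_le.2 hx)]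
    refine (hasDerivAt_of_contDiff_one hg x).congr_of_eventuallyEq ?_
    filter_upwards [Ioi_mem_nhds hx] with y hy
    exact if_neg (not_le.2 hy)

/-- A function on the line whose derivative is at least `1` has an inverse. -/
theorem exists_inverse_of_one_le_deriv {g g' : ℝ → ℝ} (hg : ∀ x, HasDerivAt g (g' x) x)
    (h1 : ∀ x, 1 ≤ g' x) :
    ∃ i : ℝ → ℝ, (∀ x, i (g x) = x) ∧ (∀ y, g (i y) = y) ∧ StrictMono g ∧ Continuous i ∧
      ∀ y, HasDerivAt i (g' (i y))⁻¹ y := by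
  have hgc : Continuous g := continuous_iff_continuousAt.2 fun x => (hg x).continuousAt
  -- Comparison with the identity yields strict monotonicity and both limits at infinity.
  have hmono : Monotone (fun x => g x - x) :=
    monotone_of_hasDerivAt_nonneg (f' := fun x => g' x - 1)
      (fun x => (hg x).sub (hasDerivAt_id x)) (fun x => sub_nonneg.2 (h1 x))
  have hstrict : StrictMono g := fun x y hxy => by
    have := hmono hxy.le
    simp only at this
    linarith
  have htop : Filter.Tendsto g Filter.atTop Filter.atTop := by
    refine Filter.tendsto_atTop_mono' _ ?_ (Filter.tendsto_atTop_add_const_right _ (g 0)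
      Filter.tendsto_id)
    filter_upwards [Filter.eventually_ge_atTop 0] with x hx
    have := hmono hx
    simp only [id] at this ⊢
    linarith
  have hbot : Filter.Tendsto g Filter.atBot Filter.atBot := by
    refine Filter.tendsto_atBot_mono' _ ?_ (Filter.tendsto_atBot_add_const_right _ (g 0)
      Filter.tendsto_id)
    filter_upwards [Filter.eventually_le_atBot 0] with x hx
    have := hmono hx
    simp only [id] at this ⊢
    linarith
  let e : ℝ ≃o ℝ := hstrict.orderIsoOfSurjective g (hgc.surjective htop hbot)
  have h2 : ∀ y, g (e.symm y) = y := fun y => e.apply_symm_apply y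
  refine ⟨e.symm, fun x => e.symm_apply_apply x, h2, hstrict, e.symm.continuous, fun y => ?_⟩
  exact HasDerivAt.of_local_left_inverse e.symm.continuous.continuousAt (hg _)
    (by linarith [h1 (e.symm y)]) (Filter.Eventually.of_forall h2)

/-- A Lipschitz function with almost everywhere nonnegative derivative increases. -/
theorem le_of_ae_hasDerivWithinAt_nonneg {f : ℝ → ℝ} {a b : ℝ} (hab : a ≤ b) {K : NNReal}
    (hf : LipschitzOnWith K f (Icc a b))
    (h : ∀ᵐ t, t ∈ Ioo a b → ∃ v, 0 ≤ v ∧ HasDerivAt f v t) : f a ≤ f b := by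
  have hac : AbsolutelyContinuousOnInterval f a b :=
    LipschitzOnWith.absolutelyContinuousOnInterval (by rwa [uIcc_of_le hab])
  have := hac.integral_deriv_eq_sub
  rw [← sub_nonneg, ← this]
  rw [intervalIntegral.integral_of_le hab, integral_Ioc_eq_integral_Ioo]
  refine setIntegral_nonneg_of_ae_restrict ?_
  rw [Filter.EventuallyLE, ae_restrict_iff' measurableSet_Ioo]
  filter_upwards [h] with t ht hmem
  obtain ⟨v, hv, hd⟩ := ht hmem
  simpa [hd.deriv] using hv

/-- A Lipschitz function whose derivative agrees almost everywhere with a continuous function `g`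
is a primitive of `g`. -/
theorem eq_integral_of_ae_hasDerivAt {f g : ℝ → ℝ} {a b : ℝ} (hab : a ≤ b) {K : NNReal}
    (hf : LipschitzOnWith K f (Icc a b))
    (h : ∀ᵐ t, t ∈ Ioo a b → HasDerivAt f (g t) t) : f b - f a = ∫ t in a..b, g t := by
  have hac : AbsolutelyContinuousOnInterval f a b :=
    LipschitzOnWith.absolutelyContinuousOnInterval (by rwa [uIcc_of_le hab])
  rw [← hac.integral_deriv_eq_sub, intervalIntegral.integral_of_le hab,
    intervalIntegral.integral_of_le hab, integral_Ioc_eq_integral_Ioo,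
    integral_Ioc_eq_integral_Ioo]
  refine integral_congr_ae ?_
  rw [Filter.EventuallyEq, ae_restrict_iff' measurableSet_Ioo]
  filter_upwards [h] with t ht hmem
  exact (ht hmem).deriv

/-- Global solutions of a scalar differential equation with a bounded Lipschitz right-hand side on
a compact time interval, extended to the line with frozen speed. -/
theorem exists_ode_solution {F : ℝ → ℝ → ℝ} {a b x₀ : ℝ} (hab : a ≤ b) {K L : NNReal}
    (hcont : Continuous (Function.uncurry F))
    (hlip : ∀ s ∈ Icc a b, LipschitzWith K (F s))
    (hbound : ∀ s ∈ Icc a b, ∀ x, |F s x| ≤ L) :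
    ∃ y y' : ℝ → ℝ, y a = x₀ ∧ Continuous y' ∧ (∀ s, HasDerivAt y (y' s) s) ∧
      (∀ s, ∃ r ∈ Icc a b, y' s = F r (y r)) ∧ ∀ s ∈ Icc a b, y' s = F s (y s) := by
  -- The radius `L * (b - a)` is the farthest a solution can travel, so one application covers all
  -- of `[a, b]`.
  have hPL : IsPicardLindelof F (tmin := a) (tmax := b) ⟨a, left_mem_Icc.2 hab⟩ x₀
      (L * ⟨b - a, sub_nonneg.2 hab⟩) 0 L K :=
    { lipschitzOnWith := fun t ht => (hlip t ht).lipschitzOnWith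
      continuousOn := fun x _ => by
        have : Continuous fun t => F t x := hcont.comp (by fun_prop : Continuous fun t => (t, x))
        exact this.continuousOn
      norm_le := fun t ht x _ => hbound t ht x
      mul_max_le := by
        simp only [sub_self, max_eq_left (sub_nonneg.2 hab), NNReal.coe_zero, sub_zero]
        exact le_of_eq rfl }
  obtain ⟨α, hα0, hα⟩ := hPL.exists_eq_forall_mem_Icc_hasDerivWithinAt (x := x₀) (by simp)
  have hαc : ContinuousOn α (Icc a b) := fun t ht => (hα t ht).continuousWithinAt
  obtain ⟨A, hA, hAα⟩ := exists_continuous_extension hab hαc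
  -- Clamping time to `[a, b]` makes the speed continuous on the line, so its primitive is
  -- differentiable everywhere and its speed is always a value of `F`.
  let c : ℝ → ℝ := fun s => projIcc a b hab s
  have hc : Continuous c := continuous_subtype_val.comp continuous_projIcc
  have hcmem : ∀ s, c s ∈ Icc a b := fun s => (projIcc a b hab s).2
  have hceq : ∀ s ∈ Icc a b, c s = s := fun s hs => by simp [c, projIcc_of_mem hab hs]
  let G : ℝ → ℝ := fun s => F (c s) (A (c s))
  have hG : Continuous G := hcont.comp (hc.prodMk (hA.comp hc))
  have hder := hasDerivAt_const_add_integral hG x₀ a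
  have hy : ∀ s ∈ Icc a b, (x₀ + ∫ r in a..s, G r) = α s := by
    refine eq_of_has_deriv_right_eq (f' := G) (fun s _ => (hder s).hasDerivWithinAt)
      (fun s hs => ?_) (fun s _ => (hder s).continuousAt.continuousWithinAt) hαc
      (by simpa using hα0.symm)
    have hs' := Ico_subset_Icc_self hs
    have : G s = F s (α s) := by simp only [G, hceq s hs', hAα hs']
    rw [this]
    exact (hα s hs').mono_of_mem_nhdsWithin (Icc_mem_nhdsGE_of_mem hs)
  refine ⟨fun s => x₀ + ∫ r in a..s, G r, G, by simp, hG, hder, fun s => ⟨c s, hcmem s, ?_⟩,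
    fun s hs => ?_⟩
  · simp only [hy _ (hcmem s), G, hAα (hcmem s)]
  · simp only [hy _ hs, G, hceq s hs, hAα hs]

/-! ### Griffith's criterion as a law for the front rate -/

/-- The rate `dℓ/dσ` of the front position in the retarded time `σ = t - ℓ`, when the incoming wave
has speed profile `p` and the toughness is `k`. -/
noncomputable def frontRate (p k : ℝ) : ℝ := max (p ^ 2 / k - 1 / 2) 0

theorem frontRate_nonneg (p k : ℝ) : 0 ≤ frontRate p k := le_max_right _ _

/-- At the front `∂ₜ y - ∂ₓ y = 2 f' (t - ℓ)`, whence the argument `2 * p`. Since `t = σ + ℓ`, a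
rate `Λ = dℓ/dσ` means `dt/dσ = 1 + Λ` and speed `Λ / (1 + Λ)`. -/
theorem frontSpeed_eq_div {p k : ℝ} (hk : 0 < k) :
    frontSpeed (2 * p) k = frontRate p k / (1 + frontRate p k) := by
  have hp : 0 ≤ p ^ 2 := sq_nonneg p
  have habs : 1 / 2 * |2 * p| ^ 2 = 2 * p ^ 2 := by rw [sq_abs]; ring
  unfold frontSpeed
  rw [habs]
  have hpos : 0 < 2 * p ^ 2 + k := by positivity
  rcases le_total (2 * p ^ 2) k with h | h
  · have h1 : frontRate p k = 0 := by
      refine max_eq_right ?_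
      rw [sub_nonpos, div_le_iff₀ hk]
      linarith
    rw [h1, max_eq_right (div_nonpos_of_nonpos_of_nonneg (by linarith) hpos.le)]
    simp
  · have h1 : frontRate p k = p ^ 2 / k - 1 / 2 := by
      refine max_eq_left ?_
      rw [sub_nonneg, le_div_iff₀ hk]
      linarith
    rw [h1, max_eq_left (div_nonneg (by linarith) hpos.le)]
    have h2 : 1 + (p ^ 2 / k - 1 / 2) = (2 * p ^ 2 + k) / (2 * k) := by field_simp; ring
    rw [h2]
    field_simp

/-- Only the toughness varies, never `p`. All Grönwall arguments compare rates at a common retarded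
time, so no modulus of continuity of `f'` is needed. -/
theorem abs_frontRate_sub_le {p P k₁ k₂ c : ℝ} (hc : 0 < c) (h₁ : c ≤ k₁) (h₂ : c ≤ k₂)
    (hp : |p| ≤ P) : |frontRate p k₁ - frontRate p k₂| ≤ P ^ 2 / c ^ 2 * |k₁ - k₂| := by
  have hk₁ : 0 < k₁ := hc.trans_le h₁
  have hk₂ : 0 < k₂ := hc.trans_le h₂
  have hpP : p ^ 2 ≤ P ^ 2 := sq_le_sq' (abs_le.1 hp).1 (abs_le.1 hp).2
  refine (abs_max_sub_max_le_abs _ _ _).trans ?_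
  have : p ^ 2 / k₁ - 1 / 2 - (p ^ 2 / k₂ - 1 / 2) = p ^ 2 / (k₁ * k₂) * (k₂ - k₁) := by
    field_simp
    ring
  rw [this, abs_mul, abs_of_nonneg (by positivity), abs_sub_comm k₂]
  gcongr
  nlinarith

theorem frontRate_le {p P k c : ℝ} (hc : 0 < c) (h : c ≤ k) (hp : |p| ≤ P) :
    frontRate p k ≤ P ^ 2 / c := by
  have hpP : p ^ 2 ≤ P ^ 2 := sq_le_sq' (abs_le.1 hp).1 (abs_le.1 hp).2
  refine max_le ?_ (by positivity)
  have : p ^ 2 / k ≤ P ^ 2 / c := by gcongr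
  linarith

/-- Griffith's criterion determines the front speed from the incoming wave. -/
theorem eq_frontRate_div_of_griffith {p k v q : ℝ} (hk : 0 < k) (hv : 0 ≤ v)
    (hq : q * (1 + v) = -2 * p) (hG : energyRelease v q ≤ k)
    (hvG : v * (energyRelease v q - k) = 0) : v = frontRate p k / (1 + frontRate p k) := by
  have h1 : 0 < 1 + v := by linarith
  -- The strain relation eliminates `q` and leaves the criterion as a condition on `v` alone.
  have hE : energyRelease v q * (1 + v) = 2 * p ^ 2 * (1 - v) := by
    unfold energyRelease
    have : q ^ 2 * (1 + v) ^ 2 = 4 * p ^ 2 := by rw [← mul_pow, hq]; ring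
    nlinarith
  -- This is `Λ = v / (1 - v)` cleared of its denominator; the two branches of the criterion are the
  -- two branches of the maximum.
  have key : frontRate p k * (1 - v) = v := by
    unfold frontRate
    rcases hv.eq_or_lt with rfl | hv'
    · have : 2 * p ^ 2 ≤ k := by nlinarith
      rw [max_eq_right]
      · simp
      · rw [sub_nonpos, div_le_iff₀ hk]
        linarith
    · have h3 : energyRelease v q = k := by
        rcases mul_eq_zero.1 hvG with h | h
        · exact absurd h hv'.ne'
        · linarith
      rw [h3] at hE
      have hlt : 0 < 1 - v := by
        by_contra hcon
        nlinarith [sq_nonneg p, mul_pos hk h1]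
      have h4 : p ^ 2 / k - 1 / 2 = v / (1 - v) := by
        field_simp
        linarith
      rw [h4, max_eq_left (by positivity)]
      field_simp
  have hΛ := frontRate_nonneg p k
  rw [eq_div_iff (by linarith)]
  linarith

/-- The front speed determined by the incoming wave satisfies Griffith's criterion. -/
theorem griffith_of_eq_frontRate_div {p k v q : ℝ} (hk : 0 < k)
    (hv : v = frontRate p k / (1 + frontRate p k)) (hq : q * (1 + v) = -2 * p) :
    0 ≤ v ∧ energyRelease v q ≤ k ∧ v * (energyRelease v q - k) = 0 := by
  have hΛ := frontRate_nonneg p k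
  have hv0 : 0 ≤ v := by rw [hv]; positivity
  have h1 : 0 < 1 + v := by linarith
  have hE : energyRelease v q * (1 + v) = 2 * p ^ 2 * (1 - v) := by
    unfold energyRelease
    have : q ^ 2 * (1 + v) ^ 2 = 4 * p ^ 2 := by rw [← mul_pow, hq]; ring
    nlinarith
  rcases le_total (p ^ 2 / k - 1 / 2) 0 with h | h
  · have h0 : frontRate p k = 0 := max_eq_right h
    have hv' : v = 0 := by rw [hv, h0]; simp
    subst hv'
    rw [sub_nonpos, div_le_iff₀ hk] at h
    refine ⟨le_rfl, by linarith, by simp⟩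
  · have h0 : frontRate p k = p ^ 2 / k - 1 / 2 := max_eq_left h
    have : energyRelease v q = k := by
      have h5 : v * (1 + frontRate p k) = frontRate p k := by
        rw [hv]; field_simp
      rw [h0] at h5
      have h6 : 2 * p ^ 2 * (1 - v) = k * (1 + v) := by
        field_simp at h5
        linarith
      exact mul_right_cancel₀ h1.ne' (hE.trans h6)
    exact ⟨hv0, this.le, by rw [this]; simp⟩

/-! ### The front curve in retarded time -/

/-- `lam` is the front position as a function of the retarded time on `[-ℓ₀, T]`. -/
structure IsFrontCurve (T ℓ₀ : ℝ) (k p lam lam' : ℝ → ℝ) : Prop where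
  init : lam (-ℓ₀) = ℓ₀
  continuous_deriv : Continuous lam'
  hasDerivAt : ∀ s, HasDerivAt lam (lam' s) s
  nonneg : ∀ s, 0 ≤ lam' s
  eq : ∀ s ∈ Icc (-ℓ₀) T, lam' s = frontRate (p s) (k (lam s))

/-- The profile `p` depends on the independent variable only, so the right-hand side is Lipschitz in
the position and bounded on `[-ℓ₀, T]`; the solution is global. -/
theorem exists_isFrontCurve {T ℓ₀ c : ℝ} {k p : ℝ → ℝ} {K : NNReal} (hT : -ℓ₀ ≤ T) (hc : 0 < c)
    (hk : LipschitzWith K k) (hck : ∀ x, c ≤ k x) (hp : Continuous p) :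
    ∃ lam lam', IsFrontCurve T ℓ₀ k p lam lam' := by
  obtain ⟨P, hP⟩ := isCompact_Icc.exists_bound_of_continuousOn (s := Icc (-ℓ₀) T) hp.continuousOn
  simp only [Real.norm_eq_abs] at hP
  have hkc := hk.continuous
  have hk0 : ∀ x, k x ≠ 0 := fun x => (hc.trans_le (hck x)).ne'
  have hcont : Continuous (Function.uncurry fun s x => frontRate (p s) (k x)) := by
    unfold frontRate Function.uncurry
    refine Continuous.max (Continuous.sub (Continuous.div (by fun_prop) (by fun_prop) ?_)
      continuous_const) continuous_const
    exact fun x => hk0 _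
  obtain ⟨y, y', h1, h2, h3, h4, h5⟩ := exists_ode_solution (x₀ := ℓ₀) hT
    (K := Real.toNNReal (P ^ 2 / c ^ 2) * K) (L := Real.toNNReal (P ^ 2 / c)) hcont
    (fun s hs => LipschitzWith.of_dist_le_mul fun x y => by
      rw [Real.dist_eq]
      refine (abs_frontRate_sub_le hc (hck x) (hck y) (hP s hs)).trans ?_
      rw [NNReal.coe_mul, mul_assoc, Real.coe_toNNReal _ (by positivity)]
      exact mul_le_mul_of_nonneg_left (hk.dist_le_mul x y) (by positivity))
    (fun s hs x => by
      rw [abs_of_nonneg (frontRate_nonneg _ _), Real.coe_toNNReal _ (by positivity)]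
      exact frontRate_le hc (hck x) (hP s hs))
  refine ⟨y, y', h1, h2, h3, fun s => ?_, h5⟩
  -- The frozen speed outside `[-ℓ₀, T]` is still a value of `frontRate`, hence nonnegative.
  obtain ⟨r, _, hr⟩ := h4 s
  rw [hr]
  exact frontRate_nonneg _ _

namespace IsFrontCurve

variable {T ℓ₀ : ℝ} {k p lam lam' : ℝ → ℝ}

theorem monotone (h : IsFrontCurve T ℓ₀ k p lam lam') : Monotone lam :=
  monotone_of_hasDerivAt_nonneg h.hasDerivAt h.nonneg

theorem continuous (h : IsFrontCurve T ℓ₀ k p lam lam') : Continuous lam :=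
  continuous_iff_continuousAt.2 fun s => (h.hasDerivAt s).continuousAt

theorem le (h : IsFrontCurve T ℓ₀ k p lam lam') {s : ℝ} (hs : -ℓ₀ ≤ s) : ℓ₀ ≤ lam s := by
  have := h.monotone hs
  rwa [h.init] at this

/-- Causality, by Grönwall: at each retarded time both rates use the same profile value, so they
differ by at most a multiple of the difference in position. -/
theorem eqOn {q mu mu' : ℝ → ℝ} {c b : ℝ} {K : NNReal} (hc : 0 < c)
    (hk : LipschitzWith K k) (hck : ∀ x, c ≤ k x) (hp : Continuous p)
    (h : IsFrontCurve T ℓ₀ k p lam lam') (h' : IsFrontCurve T ℓ₀ k q mu mu') (hb : b ≤ T)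
    (hpq : ∀ s ∈ Ico (-ℓ₀) b, p s = q s) : EqOn lam mu (Icc (-ℓ₀) b) := by
  obtain ⟨P, hP⟩ := isCompact_Icc.exists_bound_of_continuousOn (s := Icc (-ℓ₀) T) hp.continuousOn
  simp only [Real.norm_eq_abs] at hP
  intro s hs
  rw [← sub_eq_zero]
  refine eq_zero_of_abs_deriv_le_mul_abs_self_of_eq_zero_right
    (f := fun s => lam s - mu s) (f' := fun s => lam' s - mu' s) (K := P ^ 2 / c ^ 2 * K)
    (a := -ℓ₀) (b := b) ?_ (fun x _ => ?_) ?_ (fun x hx => ?_) s hs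
  · exact (h.continuous.sub h'.continuous).continuousOn
  · exact ((h.hasDerivAt x).sub (h'.hasDerivAt x)).hasDerivWithinAt
  · simp [h.init, h'.init]
  · have hxT : x ∈ Icc (-ℓ₀) T := ⟨hx.1, hx.2.le.trans hb⟩
    rw [h.eq x hxT, h'.eq x hxT, ← hpq x hx, Real.norm_eq_abs, mul_assoc]
    refine (abs_frontRate_sub_le hc (hck _) (hck _) (hP x hxT)).trans ?_
    exact mul_le_mul_of_nonneg_left (hk.dist_le_mul _ _) (by positivity)

end IsFrontCurve

/-! ### Construction of the profile by repeated reflection -/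

/-- One reflection at the front: a profile that satisfies the reflection law up to retarded time
`c` yields one that satisfies it up to `c + 2 * ℓ₀`. -/
theorem exists_reflected_profile {T ℓ₀ c₁ c : ℝ} {k f₀ U f lam lam' : ℝ → ℝ} {K : NNReal}
    (hℓ₀ : 0 < ℓ₀) (hT : -ℓ₀ ≤ T) (hc₁ : 0 < c₁) (hk : LipschitzWith K k) (hck : ∀ x, c₁ ≤ k x)
    (hU : ContDiff ℝ 1 U)
    (h0 : f₀ ℓ₀ = U ℓ₀ + f₀ (-ℓ₀))
    (h1 : deriv f₀ ℓ₀ = deriv U ℓ₀ +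
      deriv f₀ (-ℓ₀) / (1 + 2 * frontRate (deriv f₀ (-ℓ₀)) (k ℓ₀)))
    (hf₀ : ContDiff ℝ 1 f₀)
    (hf : ContDiff ℝ 1 f) (hff₀ : EqOn f f₀ (Iic ℓ₀))
    (hlam : IsFrontCurve T ℓ₀ k (deriv f) lam lam')
    (href : ∀ s ∈ Icc (-ℓ₀) (min c T), f (s + 2 * lam s) = U (s + 2 * lam s) + f s)
    (hc : -ℓ₀ ≤ c) :
    ∃ g mu mu', ContDiff ℝ 1 g ∧ EqOn g f₀ (Iic ℓ₀) ∧ IsFrontCurve T ℓ₀ k (deriv g) mu mu' ∧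
      ∀ s ∈ Icc (-ℓ₀) (min (c + 2 * ℓ₀) T), g (s + 2 * mu s) = U (s + 2 * mu s) + g s := by
  -- This map sends the retarded time `t - ℓ` of a front point to `t + ℓ`; its inverse `i` recovers
  -- the wave that was reflected there.
  have hψ : ∀ s, HasDerivAt (fun s => s + 2 * lam s) (1 + 2 * lam' s) s := fun s =>
    (hasDerivAt_id s).add ((hlam.hasDerivAt s).const_mul 2)
  obtain ⟨i, hi1, hi2, hmono, hic, hi'⟩ := exists_inverse_of_one_le_deriv hψ
    (fun s => by linarith [hlam.nonneg s])
  have hψ0 : -ℓ₀ + 2 * lam (-ℓ₀) = ℓ₀ := by rw [hlam.init]; ring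
  have hiℓ : i ℓ₀ = -ℓ₀ := by
    have := hi1 (-ℓ₀)
    simpa only [hψ0] using this
  have hderf : ∀ s < ℓ₀, deriv f s = deriv f₀ s := fun s hs =>
    Filter.EventuallyEq.deriv_eq (by
      filter_upwards [Iio_mem_nhds hs] with r hr
      exact hff₀ (show r ≤ ℓ₀ from le_of_lt hr))
  have hder2 : ∀ s, HasDerivAt (fun s => U s + f (i s))
      (deriv U s + deriv f (i s) * (1 + 2 * lam' (i s))⁻¹) s := fun s =>
    (hasDerivAt_of_contDiff_one hU s).add
      ((hasDerivAt_of_contDiff_one hf (i s)).comp s (hi' s))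
  have hdiff2 : ContDiff ℝ 1 (fun s => U s + f (i s)) := by
    refine contDiff_one_of_hasDerivAt hder2 ?_
    refine (continuous_deriv_of_contDiff_one hU).add
      (((continuous_deriv_of_contDiff_one hf).comp hic).mul (Continuous.inv₀ ?_ ?_))
    · exact continuous_const.add (continuous_const.mul (hlam.continuous_deriv.comp hic))
    · intro s
      linarith [hlam.nonneg (i s)]
  -- The pieces match to first order at `ℓ₀` by `h0` and `h1`: the denominator in `h1` is the
  -- derivative of `s + 2 * lam s` at `-ℓ₀`.
  have hg : ContDiff ℝ 1 (fun s => if s ≤ ℓ₀ then f₀ s else U s + f (i s)) := by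
    refine contDiff_one_glue hf₀ hdiff2 ?_ ?_
    · rw [hiℓ, h0, hff₀ (show -ℓ₀ ≤ ℓ₀ by linarith)]
    · rw [(hder2 ℓ₀).deriv, h1, hiℓ, hlam.eq (-ℓ₀) ⟨le_rfl, hT⟩, hlam.init,
        hderf _ (by linarith), div_eq_mul_inv]
  -- `g` obeys the reflection law along `lam`, but needs it along its own curve `mu`; causality
  -- identifies the two as far as `g` and `f` agree.
  obtain ⟨mu, mu', hmu⟩ := exists_isFrontCurve (ℓ₀ := ℓ₀) hT hc₁ hk hck
    (continuous_deriv_of_contDiff_one hg)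
  set g : ℝ → ℝ := fun s => if s ≤ ℓ₀ then f₀ s else U s + f (i s) with hgdef
  have hgψ : ∀ s, -ℓ₀ ≤ s → g (s + 2 * lam s) = U (s + 2 * lam s) + f s := by
    intro s hs
    rcases hs.eq_or_lt with rfl | hs
    · rw [hψ0, hgdef]
      simp only [le_refl, if_true]
      rw [h0, hff₀ (show -ℓ₀ ≤ ℓ₀ by linarith)]
    · have : ¬ (s + 2 * lam s ≤ ℓ₀) := by
        have := hmono hs
        simp only [hψ0] at this
        exact not_le.2 this
      rw [hgdef]
      simp only [if_neg this]
      rw [hi1 s]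
  -- Since `lam ≥ ℓ₀`, a point `s` in this range beyond `ℓ₀` has preimage `i s ≤ min c T`, where `f`
  -- already satisfies the law.
  have hfg : ∀ s, s ≤ min c T + 2 * ℓ₀ → g s = f s := by
    intro s hs
    rcases le_or_gt s ℓ₀ with hsℓ | hsℓ
    · rw [hgdef]
      simp only [if_pos hsℓ]
      rw [hff₀ hsℓ]
    · have h3 : -ℓ₀ ≤ i s := by
        by_contra hcon
        have := hmono (not_le.1 hcon)
        simp only [hi2, hψ0] at this
        linarith
      have h4 : i s ≤ min c T := by
        by_contra hcon
        have := hmono (not_le.1 hcon)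
        simp only [hi2] at this
        linarith [hlam.le (s := min c T) (le_min hc hT)]
      have h5 := hgψ (i s) h3
      have h6 := href (i s) ⟨h3, h4⟩
      simp only [hi2] at h5 h6
      rw [h5, h6]
  have heq : EqOn lam mu (Icc (-ℓ₀) (min (c + 2 * ℓ₀) T)) := by
    refine hlam.eqOn hc₁ hk hck (continuous_deriv_of_contDiff_one hf) hmu (min_le_right _ _) ?_
    intro s hs
    refine (Filter.EventuallyEq.deriv_eq ?_).symm
    have : s < min c T + 2 * ℓ₀ := by
      rw [min_add]
      exact hs.2.trans_le (min_le_min le_rfl (by linarith))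
    filter_upwards [Iio_mem_nhds this] with r hr
    exact hfg r (le_of_lt hr)
  refine ⟨g, mu, mu', hg, fun s hs => if_pos hs, hmu, fun s hs => ?_⟩
  rw [← heq hs, hgψ s hs.1, hfg s]
  rw [min_add]
  exact hs.2.trans (min_le_min le_rfl (by linarith))

/-- Existence of the profile `f` and of the front curve. -/
theorem exists_profile_frontCurve {T ℓ₀ c₁ : ℝ} {k f₀ U : ℝ → ℝ} {K : NNReal}
    (hℓ₀ : 0 < ℓ₀) (hT : -ℓ₀ ≤ T) (hc₁ : 0 < c₁) (hk : LipschitzWith K k) (hck : ∀ x, c₁ ≤ k x)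
    (hU : ContDiff ℝ 1 U) (hf₀ : ContDiff ℝ 1 f₀)
    (h0 : f₀ ℓ₀ = U ℓ₀ + f₀ (-ℓ₀))
    (h1 : deriv f₀ ℓ₀ = deriv U ℓ₀ +
      deriv f₀ (-ℓ₀) / (1 + 2 * frontRate (deriv f₀ (-ℓ₀)) (k ℓ₀))) :
    ∃ f lam lam', ContDiff ℝ 1 f ∧ EqOn f f₀ (Iic ℓ₀) ∧
      IsFrontCurve T ℓ₀ k (deriv f) lam lam' ∧
      ∀ s ∈ Icc (-ℓ₀) T, f (s + 2 * lam s) = U (s + 2 * lam s) + f s := by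
  -- For `n = 0` only the point `-ℓ₀` is concerned and the law is `h0`; each reflection adds `2 *
  -- ℓ₀`.
  have key : ∀ n : ℕ, ∃ f lam lam', ContDiff ℝ 1 f ∧ EqOn f f₀ (Iic ℓ₀) ∧
      IsFrontCurve T ℓ₀ k (deriv f) lam lam' ∧
      ∀ s ∈ Icc (-ℓ₀) (min (-ℓ₀ + n * (2 * ℓ₀)) T),
        f (s + 2 * lam s) = U (s + 2 * lam s) + f s := by
    intro n
    induction n with
    | zero =>
      obtain ⟨lam, lam', hlam⟩ := exists_isFrontCurve (ℓ₀ := ℓ₀) hT hc₁ hk hck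
        (continuous_deriv_of_contDiff_one hf₀)
      refine ⟨f₀, lam, lam', hf₀, fun _ _ => rfl, hlam, fun s hs => ?_⟩
      have : s = -ℓ₀ := le_antisymm (by simpa using hs.2.trans (min_le_left _ _)) hs.1
      subst this
      rw [hlam.init, show -ℓ₀ + 2 * ℓ₀ = ℓ₀ by ring, h0]
    | succ n ih =>
      obtain ⟨f, lam, lam', hf, hff₀, hlam, href⟩ := ih
      obtain ⟨g, mu, mu', hg, hgf₀, hmu, h⟩ := exists_reflected_profile hℓ₀ hT hc₁ hk hck hU h0 h1
        hf₀ hf hff₀ hlam href (le_add_of_nonneg_right (by positivity))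
      refine ⟨g, mu, mu', hg, hgf₀, hmu, fun s hs => h s ⟨hs.1, ?_⟩⟩
      convert hs.2 using 2
      push_cast
      ring
  obtain ⟨n, hn⟩ := exists_nat_ge ((T + ℓ₀) / (2 * ℓ₀))
  obtain ⟨f, lam, lam', hf, hff₀, hlam, href⟩ := key n
  refine ⟨f, lam, lam', hf, hff₀, hlam, fun s hs => href s ⟨hs.1, le_min ?_ hs.2⟩⟩
  rw [div_le_iff₀ (by positivity)] at hn
  linarith [hs.2]

/-! ### Travelling waves as distributional solutions -/

/-- The superposition of the travelling waves `f (t - x)` and `h (t + x)`. -/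
def dAlembert (f h : ℝ → ℝ) (p : ℝ × ℝ) : ℝ := f (p.1 - p.2) + h (p.1 + p.2)

theorem hasFDerivAt_fderiv_apply {φ : ℝ × ℝ → ℝ} (hφ : ContDiff ℝ ∞ φ) (v p : ℝ × ℝ) :
    HasFDerivAt (fun q => fderiv ℝ φ q v)
      ((ContinuousLinearMap.apply ℝ ℝ v).comp (fderiv ℝ (fderiv ℝ φ) p)) p := by
  have h1 : ContDiff ℝ ∞ (fderiv ℝ φ) := hφ.fderiv_right (by simp)
  have h2 := (h1.differentiable (by simp) p).hasFDerivAt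
  exact (ContinuousLinearMap.apply ℝ ℝ v).hasFDerivAt.comp p h2

theorem iteratedDeriv_two_fst {φ : ℝ × ℝ → ℝ} (hφ : ContDiff ℝ ∞ φ) (p : ℝ × ℝ) :
    iteratedDeriv 2 (fun t => φ (t, p.2)) p.1 = fderiv ℝ (fderiv ℝ φ) p (1, 0) (1, 0) := by
  have h0 : ∀ t : ℝ, HasDerivAt (fun t : ℝ => (t, p.2)) ((1 : ℝ), (0 : ℝ)) t := fun t =>
    (hasDerivAt_id t).prodMk (hasDerivAt_const t p.2)
  have h1 : deriv (fun t => φ (t, p.2)) = fun t => fderiv ℝ φ (t, p.2) (1, 0) := by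
    funext t
    exact ((hφ.differentiable (by simp) (t, p.2)).hasFDerivAt.comp_hasDerivAt t (h0 t)).deriv
  rw [iteratedDeriv_succ, iteratedDeriv_one, h1]
  exact ((hasFDerivAt_fderiv_apply hφ (1, 0) p).comp_hasDerivAt p.1 (h0 p.1)).deriv

theorem iteratedDeriv_two_snd {φ : ℝ × ℝ → ℝ} (hφ : ContDiff ℝ ∞ φ) (p : ℝ × ℝ) :
    iteratedDeriv 2 (fun x => φ (p.1, x)) p.2 = fderiv ℝ (fderiv ℝ φ) p (0, 1) (0, 1) := by
  have h0 : ∀ x : ℝ, HasDerivAt (fun x : ℝ => (p.1, x)) ((0 : ℝ), (1 : ℝ)) x := fun x =>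
    (hasDerivAt_const x p.1).prodMk (hasDerivAt_id x)
  have h1 : deriv (fun x => φ (p.1, x)) = fun x => fderiv ℝ φ (p.1, x) (0, 1) := by
    funext x
    exact ((hφ.differentiable (by simp) (p.1, x)).hasFDerivAt.comp_hasDerivAt x (h0 x)).deriv
  rw [iteratedDeriv_succ, iteratedDeriv_one, h1]
  exact ((hasFDerivAt_fderiv_apply hφ (0, 1) p).comp_hasDerivAt p.2 (h0 p.2)).deriv

/-- The wave operator factors into the derivatives along the two characteristic directions. -/
theorem waveOp_eq {φ : ℝ × ℝ → ℝ} (hφ : ContDiff ℝ ∞ φ) (p : ℝ × ℝ) {ε : ℝ} (hε : ε ^ 2 = 1) :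
    waveOp φ p = fderiv ℝ (fderiv ℝ φ) p (1, ε) (1, -ε) := by
  have hs : IsSymmSndFDerivAt ℝ φ p := hφ.contDiffAt.isSymmSndFDerivAt (by
    rw [minSmoothness_of_isRCLikeNormedField]
    exact ENat.LEInfty.out)
  have h1 : ∀ a : ℝ, ((1 : ℝ), a) = (1, 0) + a • ((0 : ℝ), (1 : ℝ)) := fun a => by simp
  rw [waveOp, iteratedDeriv_two_fst hφ, iteratedDeriv_two_snd hφ, h1 ε, h1 (-ε)]
  simp only [map_add, map_smul, add_apply, smul_apply,
    smul_eq_mul]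
  rw [hs.eq (0, 1) (1, 0)]
  linear_combination (fderiv ℝ (fderiv ℝ φ) p (0, 1) (0, 1)) * hε

/-- A continuous function that is constant along one of the characteristic directions is a weak
solution of the wave equation. -/
theorem integral_mul_waveOp_eq_zero {F : ℝ × ℝ → ℝ} (hF : Continuous F) {ε : ℝ} (hε : ε ^ 2 = 1)
    (hconst : ∀ p (s : ℝ), F (p + s • (1, ε)) = F p) {φ : ℝ × ℝ → ℝ} (hφ : ContDiff ℝ ∞ φ)
    (hc : HasCompactSupport φ) :
    Integrable (fun p => F p * waveOp φ p) ∧ ∫ p, F p * waveOp φ p = 0 := by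
  have hD : ∀ p, waveOp φ p = fderiv ℝ (fderiv ℝ φ) p (1, ε) (1, -ε) := fun p => waveOp_eq hφ p hε
  simp only [hD]
  have hφ1 : ContDiff ℝ ∞ (fderiv ℝ φ) := hφ.fderiv_right (by simp)
  have hφ2 : ContDiff ℝ ∞ (fderiv ℝ (fderiv ℝ φ)) := hφ1.fderiv_right (by simp)
  have hc1 : HasCompactSupport (fderiv ℝ φ) := hc.fderiv ℝ
  have hc2 : HasCompactSupport (fderiv ℝ (fderiv ℝ φ)) := hc1.fderiv ℝ
  have i1 : Integrable fun p => F p * fderiv ℝ (fderiv ℝ φ) p (1, ε) (1, -ε) := by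
    refine Continuous.integrable_of_hasCompactSupport ?_ ?_
    · exact hF.mul ((hφ2.continuous.clm_apply continuous_const).clm_apply continuous_const)
    · exact (hc2.comp_left
        (g := fun A : (ℝ × ℝ) →L[ℝ] (ℝ × ℝ) →L[ℝ] ℝ => A (1, ε) (1, -ε)) (by simp)).mul_left
  have i2 : Integrable fun p => F p * fderiv ℝ φ p (1, -ε) := by
    refine Continuous.integrable_of_hasCompactSupport ?_ ?_
    · exact hF.mul (hφ1.continuous.clm_apply continuous_const)
    · exact (hc1.comp_left
        (g := fun A : (ℝ × ℝ) →L[ℝ] ℝ => A (1, -ε)) (by simp)).mul_left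
  refine ⟨i1, ?_⟩
  -- Integration by parts along `(1, ε)` moves one derivative onto `F`, whose line derivative in
  -- that direction is zero; `F` need not be differentiable otherwise.
  have := integral_bilinear_hasLineDerivAt_right_eq_neg_left_of_integrable
    (μ := (volume : Measure (ℝ × ℝ)))
    (B := ContinuousLinearMap.mul ℝ ℝ) (v := ((1 : ℝ), ε)) (f := F) (f' := fun _ => 0)
    (g := fun p => fderiv ℝ φ p (1, -ε))
    (g' := fun p => fderiv ℝ (fderiv ℝ φ) p (1, ε) (1, -ε)) (by simp) (by simpa using i1)
    (by simpa using i2) (fun p _ => ?_) (fun p _ => ?_)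
  · simpa using this
  · unfold HasLineDerivAt
    simp only [hconst]
    exact hasDerivAt_const _ _
  · exact (hasFDerivAt_fderiv_apply hφ (1, -ε) p).hasLineDerivAt (1, ε)

theorem weakWave_dAlembert {f h : ℝ → ℝ} (hf : Continuous f) (hh : Continuous h) (T : ℝ)
    (ℓ : ℝ → ℝ) : WeakWave T ℓ (dAlembert f h) := by
  intro φ hφ hc _
  obtain ⟨i1, e1⟩ := integral_mul_waveOp_eq_zero (F := fun p => f (p.1 - p.2)) (ε := 1)
    (by fun_prop) (by norm_num)
    (fun p s => by congr 1; simp) hφ hc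
  obtain ⟨i2, e2⟩ := integral_mul_waveOp_eq_zero (F := fun p => h (p.1 + p.2)) (ε := -1)
    (by fun_prop) (by norm_num)
    (fun p s => by congr 1; simp; ring) hφ hc
  simp only [dAlembert, add_mul]
  rw [integral_add i1 i2, e1, e2, add_zero]

/-! ### Characteristic coordinates and approximate parallelogram identity -/

/-- The point `(t, x)` with characteristic coordinates `t - x = a` and `t + x = b`. -/
noncomputable def charPoint (a b : ℝ) : ℝ × ℝ := ((a + b) / 2, (b - a) / 2)

theorem charPoint_sub_add (p : ℝ × ℝ) : charPoint (p.1 - p.2) (p.1 + p.2) = p := by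
  ext <;> simp only [charPoint] <;> ring

theorem dist_charPoint_le {a b a' b' ε : ℝ} (ha : |a - a'| ≤ ε) (hb : |b - b'| ≤ ε) :
    dist (charPoint a b) (charPoint a' b') ≤ ε := by
  rw [abs_le] at ha hb
  rw [Prod.dist_eq, max_le_iff, Real.dist_eq, Real.dist_eq, abs_le, abs_le]
  simp only [charPoint]
  refine ⟨⟨?_, ?_⟩, ?_, ?_⟩ <;> linarith

theorem continuous_charPoint : Continuous fun q : ℝ × ℝ => charPoint q.1 q.2 := by
  unfold charPoint
  fun_prop

/-- The wave operator applied to a product of functions of the characteristic coordinates. -/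
theorem waveOp_mul {A B A' B' : ℝ → ℝ} (hA : ContDiff ℝ ∞ A) (hB : ContDiff ℝ ∞ B)
    (hA' : ∀ s, HasDerivAt A (A' s) s) (hB' : ∀ s, HasDerivAt B (B' s) s) (p : ℝ × ℝ) :
    waveOp (fun p => A (p.1 - p.2) * B (p.1 + p.2)) p =
      4 * (A' (p.1 - p.2) * B' (p.1 + p.2)) := by
  have hφ : ContDiff ℝ ∞ fun p : ℝ × ℝ => A (p.1 - p.2) * B (p.1 + p.2) :=
    (hA.comp (contDiff_fst.sub contDiff_snd)).mul (hB.comp (contDiff_fst.add contDiff_snd))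
  have h1 : ∀ q : ℝ × ℝ, fderiv ℝ (fun p : ℝ × ℝ => A (p.1 - p.2) * B (p.1 + p.2)) q (1, -1) =
      2 * A' (q.1 - q.2) * B (q.1 + q.2) := by
    intro q
    have h2 := ((hφ.differentiable (by simp) q).hasFDerivAt.hasLineDerivAt (1, -1))
    refine HasDerivAt.unique h2 ?_
    have ha : HasDerivAt (fun t : ℝ => q.1 - q.2 + 2 * t) 2 0 := by
      simpa using ((hasDerivAt_id (0 : ℝ)).const_mul 2).const_add (q.1 - q.2)
    have hA2 := (HasDerivAt.comp (h₂ := A) (0 : ℝ) (by simpa using hA' (q.1 - q.2)) ha).mul_const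
      (B (q.1 + q.2))
    refine (hA2.congr_of_eventuallyEq (Filter.Eventually.of_forall fun t => ?_)).congr_deriv ?_
    · simp only [Prod.fst_add, Prod.snd_add, Prod.smul_fst, Prod.smul_snd, smul_eq_mul,
        Function.comp]
      ring_nf
    · ring
  rw [waveOp_eq hφ p (ε := 1) (by norm_num)]
  have h3 := (hasFDerivAt_fderiv_apply hφ (1, -1) p).hasLineDerivAt (1, 1)
  refine HasDerivAt.unique h3 ?_
  simp only [h1]
  have hb : HasDerivAt (fun t : ℝ => p.1 + p.2 + 2 * t) 2 0 := by
    simpa using ((hasDerivAt_id (0 : ℝ)).const_mul 2).const_add (p.1 + p.2)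
  have hB2 := (HasDerivAt.comp (h₂ := B) (0 : ℝ) (by simpa using hB' (p.1 + p.2)) hb).const_mul
    (2 * A' (p.1 - p.2))
  refine (hB2.congr_of_eventuallyEq (Filter.Eventually.of_forall fun t => ?_)).congr_deriv ?_
  · simp only [Prod.fst_add, Prod.snd_add, Prod.smul_fst, Prod.smul_snd, smul_eq_mul,
      Function.comp]
    ring_nf
  · ring

/-- Smooth steps: for each `ε > 0` a smooth function that is constant outside `(-ε, ε)`, with a
nonnegative derivative that does not vanish at `0`. -/
theorem exists_smooth_step {ε : ℝ} (hε : 0 < ε) : ∃ R ρ : ℝ → ℝ, ContDiff ℝ ∞ R ∧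
    (∀ s, HasDerivAt R (ρ s) s) ∧ Continuous ρ ∧ (∀ s, 0 ≤ ρ s) ∧ 0 < ρ 0 ∧
    (∀ s, ε ≤ |s| → ρ s = 0) ∧ (∀ s ≤ -ε, R s = 0) ∧ (∀ s, ε ≤ s → R s = R ε) := by
  let ρ : ContDiffBump (0 : ℝ) := ⟨ε / 2, ε, by positivity, by linarith⟩
  have hρ0 : ∀ s, ε ≤ |s| → ρ s = 0 := fun s hs =>
    ρ.zero_of_le_dist (by simpa [Real.dist_eq] using hs)
  have hder : ∀ s, HasDerivAt (fun s => ∫ r in (-ε)..s, ρ r) (ρ s) s := fun s => by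
    simpa using hasDerivAt_const_add_integral ρ.continuous 0 (-ε) s
  have hzero : ∀ a b, (∀ s ∈ uIcc a b, ε ≤ |s|) → ∫ r in a..b, ρ r = 0 := fun a b h => by
    rw [intervalIntegral.integral_congr (g := fun _ => (0 : ℝ)) fun s hs => hρ0 s (h s hs)]
    simp
  refine ⟨fun s => ∫ r in (-ε)..s, ρ r, ρ, ?_, hder, ρ.continuous, fun s => ρ.nonneg, ?_, hρ0,
    fun s hs => hzero _ _ fun r hr => ?_, fun s hs => ?_⟩
  · rw [contDiff_infty_iff_deriv]
    refine ⟨fun s => (hder s).differentiableAt, ?_⟩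
    rw [show deriv (fun s => ∫ r in (-ε)..s, ρ r) = ρ from funext fun s => (hder s).deriv]
    exact ρ.contDiff
  · exact ρ.pos_of_mem_ball (by simpa using hε)
  · rw [uIcc_of_ge hs] at hr
    rw [abs_of_nonpos (by linarith [hr.2])]
    linarith [hr.2]
  · have h1 := intervalIntegral.integral_add_adjacent_intervals
      (ρ.continuous.intervalIntegrable (μ := volume) (-ε) ε)
      (ρ.continuous.intervalIntegrable (μ := volume) ε s)
    rw [hzero ε s fun r hr => ?_, add_zero] at h1
    · exact h1.symm
    · rw [uIcc_of_le hs] at hr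
      exact hr.1.trans (le_abs_self r)

/-- Averages of a Lipschitz function against a kernel concentrated near a point. -/
theorem abs_integral_mul_sub_le {Z w : ℝ × ℝ → ℝ} {P : ℝ × ℝ} {K : NNReal} {ε : ℝ}
    (hZ : LipschitzWith K Z) (hw : Continuous w) (hwc : HasCompactSupport w) (hw0 : ∀ p, 0 ≤ w p)
    (hsupp : ∀ p, w p ≠ 0 → dist p P ≤ ε) :
    Integrable (fun p => Z p * w p) ∧
      |(∫ p, Z p * w p) - Z P * ∫ p, w p| ≤ K * ε * ∫ p, w p := by
  have i0 : Integrable w := hw.integrable_of_hasCompactSupport hwc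
  have i1 : Integrable fun p => Z p * w p :=
    (hZ.continuous.mul hw).integrable_of_hasCompactSupport hwc.mul_left
  refine ⟨i1, ?_⟩
  rw [← integral_const_mul, ← integral_sub i1 (i0.const_mul _), ← integral_const_mul]
  rw [← Real.norm_eq_abs]
  refine norm_integral_le_of_norm_le (i0.const_mul _) (Filter.Eventually.of_forall fun p => ?_)
  rw [← sub_mul, norm_mul, Real.norm_of_nonneg (hw0 p)]
  by_cases hp : w p = 0
  · simp [hp]
  · refine mul_le_mul_of_nonneg_right ?_ (hw0 p)
    have := hZ.dist_le_mul p P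
    rw [Real.dist_eq] at this
    exact this.trans (mul_le_mul_of_nonneg_left (hsupp p hp) K.coe_nonneg)

/-- The product kernel `ρ (t - x - α) * ρ (t + x - β)`. -/
theorem charKernel_properties {ρ : ℝ → ℝ} {ε : ℝ} (hρ : Continuous ρ)
    (hρ1 : ∀ s, ε ≤ |s| → ρ s = 0) (α β : ℝ) :
    Continuous (fun p : ℝ × ℝ => ρ (p.1 - p.2 - α) * ρ (p.1 + p.2 - β)) ∧
    HasCompactSupport (fun p : ℝ × ℝ => ρ (p.1 - p.2 - α) * ρ (p.1 + p.2 - β)) ∧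
    (∀ p : ℝ × ℝ, ρ (p.1 - p.2 - α) * ρ (p.1 + p.2 - β) ≠ 0 → dist p (charPoint α β) ≤ ε) ∧
    ∫ p : ℝ × ℝ, ρ (p.1 - p.2 - α) * ρ (p.1 + p.2 - β) =
      ∫ p : ℝ × ℝ, ρ (p.1 - p.2) * ρ (p.1 + p.2) := by
  have hs : ∀ p : ℝ × ℝ, ρ (p.1 - p.2 - α) * ρ (p.1 + p.2 - β) ≠ 0 →
      dist p (charPoint α β) ≤ ε := fun p hp => by
    have h1 : |p.1 - p.2 - α| ≤ ε := by
      by_contra hcon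
      exact hp (by rw [hρ1 _ (not_le.1 hcon).le, zero_mul])
    have h2 : |p.1 + p.2 - β| ≤ ε := by
      by_contra hcon
      exact hp (by rw [hρ1 _ (not_le.1 hcon).le, mul_zero])
    rw [← charPoint_sub_add p]
    exact dist_charPoint_le h1 h2
  refine ⟨by fun_prop, ?_, hs, ?_⟩
  · exact HasCompactSupport.of_support_subset_isCompact
      (isCompact_closedBall (charPoint α β) ε) fun p hp => hs p hp
  · rw [← integral_sub_right_eq_self (fun p : ℝ × ℝ => ρ (p.1 - p.2) * ρ (p.1 + p.2))
      (charPoint α β)]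
    congr 1
    funext p
    simp only [charPoint, Prod.fst_sub, Prod.snd_sub]
    ring_nf

/-- The parallelogram identity for a weak solution, up to an error that is linear in the distance
from the rectangle to the boundary. -/
theorem abs_parallelogram_le {T : ℝ} {m : ℝ → ℝ} {z : ℝ × ℝ → ℝ} {K : NNReal}
    (hw : WeakWave T m z) (hz : LipschitzOnWith K z (domain T m)) {α₁ α₂ β₁ β₂ ε : ℝ} (hε : 0 < ε)
    (hα : α₁ ≤ α₂) (hβ : β₁ ≤ β₂)
    (hsub : ∀ a ∈ Icc (α₁ - ε) (α₂ + ε), ∀ b ∈ Icc (β₁ - ε) (β₂ + ε),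
      charPoint a b ∈ openDomain T m) :
    |z (charPoint α₁ β₁) + z (charPoint α₂ β₂) - z (charPoint α₁ β₂) - z (charPoint α₂ β₁)| ≤
      4 * K * ε := by
  obtain ⟨R, ρ, hR, hRρ, hρc, hρ0, hρpos, hρ1, hRl, hRr⟩ := exists_smooth_step hε
  -- The global extension lets the four kernels be integrated separately over the whole plane.
  obtain ⟨Z, hZ, hzZ⟩ := hz.extend_real
  have hod : openDomain T m ⊆ domain T m := fun p hp =>
    ⟨hp.1.le, hp.2.1.le, hp.2.2.1.le, hp.2.2.2.le⟩
  -- These are smoothed indicators of `[γ₁, γ₂]`, with derivative a bump at `γ₁` minus a bump at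
  -- `γ₂`. For their product the wave operator is therefore four kernels of alternating sign at the
  -- vertices of the rectangle.
  have hstep : ∀ γ₁ γ₂ : ℝ, γ₁ ≤ γ₂ → ContDiff ℝ ∞ (fun s => R (s - γ₁) - R (s - γ₂)) ∧
      (∀ s, HasDerivAt (fun s => R (s - γ₁) - R (s - γ₂)) (ρ (s - γ₁) - ρ (s - γ₂)) s) ∧
      ∀ s, s ∉ Icc (γ₁ - ε) (γ₂ + ε) → R (s - γ₁) - R (s - γ₂) = 0 ∧
        ρ (s - γ₁) = 0 ∧ ρ (s - γ₂) = 0 := by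
    intro γ₁ γ₂ hγ
    refine ⟨(hR.comp (contDiff_id.sub contDiff_const)).sub
      (hR.comp (contDiff_id.sub contDiff_const)), fun s => ?_, fun s hs => ?_⟩
    · exact ((hRρ _).comp_sub_const s γ₁).sub ((hRρ _).comp_sub_const s γ₂)
    · rcases lt_or_ge s (γ₁ - ε) with h | h
      · rw [hRl _ (by linarith), hRl _ (by linarith)]
        refine ⟨by simp, hρ1 _ ?_, hρ1 _ ?_⟩
        · exact le_trans (by linarith) (neg_le_abs (s - γ₁))
        · exact le_trans (by linarith) (neg_le_abs (s - γ₂))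
      · have h2 : γ₂ + ε < s := by
          by_contra hcon
          exact hs ⟨h, not_lt.1 hcon⟩
        rw [hRr _ (by linarith), hRr (s - γ₂) (by linarith)]
        refine ⟨by simp, hρ1 _ ?_, hρ1 _ ?_⟩
        · exact le_trans (by linarith) (le_abs_self (s - γ₁))
        · exact le_trans (by linarith) (le_abs_self (s - γ₂))
  obtain ⟨hA, hA', hA0⟩ := hstep α₁ α₂ hα
  obtain ⟨hB, hB', hB0⟩ := hstep β₁ β₂ hβ
  set A : ℝ → ℝ := fun s => R (s - α₁) - R (s - α₂) with hAdef
  set B : ℝ → ℝ := fun s => R (s - β₁) - R (s - β₂) with hBdef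
  let S : Set (ℝ × ℝ) :=
    (fun q : ℝ × ℝ => charPoint q.1 q.2) '' (Icc (α₁ - ε) (α₂ + ε) ×ˢ Icc (β₁ - ε) (β₂ + ε))
  have hS : IsCompact S := (isCompact_Icc.prod isCompact_Icc).image continuous_charPoint
  have hSmem : ∀ p : ℝ × ℝ, p.1 - p.2 ∈ Icc (α₁ - ε) (α₂ + ε) →
      p.1 + p.2 ∈ Icc (β₁ - ε) (β₂ + ε) → p ∈ S := fun p h1 h2 =>
    ⟨(p.1 - p.2, p.1 + p.2), ⟨h1, h2⟩, charPoint_sub_add p⟩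
  have hSdom : S ⊆ openDomain T m := by
    rintro _ ⟨q, ⟨h1, h2⟩, rfl⟩
    exact hsub _ h1 _ h2
  have hsupp : Function.support (fun p : ℝ × ℝ => A (p.1 - p.2) * B (p.1 + p.2)) ⊆ S := by
    intro p hp
    refine hSmem p ?_ ?_
    · by_contra hcon
      exact hp (by
        have h := (hA0 _ hcon).1
        simp only [hAdef]
        rw [h, zero_mul])
    · by_contra hcon
      exact hp (by
        have h := (hB0 _ hcon).1
        simp only [hBdef]
        rw [h, mul_zero])
  have hint := hw (fun p => A (p.1 - p.2) * B (p.1 + p.2))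
    ((hA.comp (contDiff_fst.sub contDiff_snd)).mul (hB.comp (contDiff_fst.add contDiff_snd)))
    (HasCompactSupport.of_support_subset_isCompact hS hsupp)
    ((closure_minimal hsupp hS.isClosed).trans hSdom)
  let w : ℝ → ℝ → ℝ × ℝ → ℝ := fun α β p => ρ (p.1 - p.2 - α) * ρ (p.1 + p.2 - β)
  have hzw : ∀ p, z p * waveOp (fun p => A (p.1 - p.2) * B (p.1 + p.2)) p =
      4 * (Z p * w α₁ β₁ p + Z p * w α₂ β₂ p - Z p * w α₁ β₂ p - Z p * w α₂ β₁ p) := by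
    intro p
    rw [waveOp_mul hA hB hA' hB']
    simp only [w]
    by_cases hp : p ∈ S
    · rw [hzZ (hod (hSdom hp))]
      ring
    · by_cases ha : p.1 - p.2 ∈ Icc (α₁ - ε) (α₂ + ε)
      · have hb : p.1 + p.2 ∉ Icc (β₁ - ε) (β₂ + ε) := fun hb => hp (hSmem p ha hb)
        simp [(hB0 _ hb).2.1, (hB0 _ hb).2.2]
      · simp [(hA0 _ ha).2.1, (hA0 _ ha).2.2]
  simp only [hzw] at hint
  -- By translation invariance all four kernels have mass `c`. It divides out at the end, leaving an
  -- error `K * ε` per vertex.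
  set c := ∫ p : ℝ × ℝ, ρ (p.1 - p.2) * ρ (p.1 + p.2) with hcdef
  have hc : 0 < c := by
    obtain ⟨h1, h2, -, -⟩ := charKernel_properties hρc hρ1 0 0
    simp only [sub_zero] at h1 h2
    refine Continuous.integral_pos_of_hasCompactSupport_nonneg_nonzero (x := 0) h1 h2
      (fun p => mul_nonneg (hρ0 _) (hρ0 _)) ?_
    simp [hρpos.ne']
  have hav : ∀ α β, charPoint α β ∈ domain T m → Integrable (fun p => Z p * w α β p) ∧
      |(∫ p, Z p * w α β p) - z (charPoint α β) * c| ≤ K * ε * c := by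
    intro α β hmem
    obtain ⟨h1, h2, h3, h4⟩ := charKernel_properties hρc hρ1 α β
    have := abs_integral_mul_sub_le hZ h1 h2 (fun p => mul_nonneg (hρ0 _) (hρ0 _)) h3
    rw [h4, ← hzZ hmem] at this
    exact this
  have hα₁ : α₁ ∈ Icc (α₁ - ε) (α₂ + ε) := ⟨by linarith, by linarith⟩
  have hα₂ : α₂ ∈ Icc (α₁ - ε) (α₂ + ε) := ⟨by linarith, by linarith⟩
  have hβ₁ : β₁ ∈ Icc (β₁ - ε) (β₂ + ε) := ⟨by linarith, by linarith⟩
  have hβ₂ : β₂ ∈ Icc (β₁ - ε) (β₂ + ε) := ⟨by linarith, by linarith⟩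
  obtain ⟨i11, e11⟩ := hav α₁ β₁ (hod (hsub _ hα₁ _ hβ₁))
  obtain ⟨i12, e12⟩ := hav α₁ β₂ (hod (hsub _ hα₁ _ hβ₂))
  obtain ⟨i21, e21⟩ := hav α₂ β₁ (hod (hsub _ hα₂ _ hβ₁))
  obtain ⟨i22, e22⟩ := hav α₂ β₂ (hod (hsub _ hα₂ _ hβ₂))
  have hsum : ∫ p, (Z p * w α₁ β₁ p + Z p * w α₂ β₂ p - Z p * w α₁ β₂ p - Z p * w α₂ β₁ p) =
      (∫ p, Z p * w α₁ β₁ p) + (∫ p, Z p * w α₂ β₂ p) - (∫ p, Z p * w α₁ β₂ p) -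
        ∫ p, Z p * w α₂ β₁ p := by
    rw [← integral_add i11 i22]
    have i3 : Integrable fun p => Z p * w α₁ β₁ p + Z p * w α₂ β₂ p := i11.add i22
    rw [← integral_sub i3 i12]
    exact integral_sub (i3.sub i12) i21
  rw [integral_const_mul, hsum] at hint
  refine le_of_mul_le_mul_right ?_ hc
  rw [← abs_of_pos hc, ← abs_mul, abs_of_pos hc]
  rw [abs_le] at *
  constructor <;> linarith

/-! ### Slow fronts and the exact parallelogram identity -/

/-- Fronts that do not recede and do not exceed the unit speed. -/
def IsSlowFront (T : ℝ) (m : ℝ → ℝ) : Prop :=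
  ∀ s t, 0 ≤ s → s ≤ t → t ≤ T → m s ≤ m t ∧ m t ≤ m s + (t - s)

/-- The parallelogram identity for characteristic rectangles with vertices in the closed domain. -/
theorem parallelogram_identity {T : ℝ} {m : ℝ → ℝ} {z : ℝ × ℝ → ℝ} {K : NNReal}
    (hm : IsSlowFront T m)
    (hw : WeakWave T m z) (hz : LipschitzOnWith K z (domain T m)) {a₁ a₂ b₁ b₂ : ℝ}
    (ha : a₁ ≤ a₂) (hb : b₁ ≤ b₂) (h0 : 0 ≤ a₁ + b₁) (hT : a₂ + b₂ ≤ 2 * T) (hab : a₂ ≤ b₁)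
    (hfront : (b₂ - a₁) / 2 ≤ m ((a₁ + b₂) / 2)) :
    z (charPoint a₁ b₁) + z (charPoint a₂ b₂) = z (charPoint a₁ b₂) + z (charPoint a₂ b₁) := by
  rcases ha.eq_or_lt with rfl | ha
  · ring
  rcases hb.eq_or_lt with rfl | hb
  · ring
  -- Only the corner `(a₁, b₂)`, of largest `x`, must lie under the front: at earlier times the unit
  -- speed bound keeps the rectangle below it, at later times monotonicity does.
  have hopen : ∀ ε > 0, ∀ a ∈ Icc (a₁ + ε) (a₂ - ε), ∀ b ∈ Icc (b₁ + ε) (b₂ - ε),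
      charPoint a b ∈ openDomain T m := by
    intro ε hε a ⟨ha1, ha2⟩ b ⟨hb1, hb2⟩
    simp only [charPoint, openDomain, mem_ofPred_eq]
    refine ⟨by linarith, by linarith, by linarith, ?_⟩
    rcases le_total ((a + b) / 2) ((a₁ + b₂) / 2) with h | h
    · have := (hm _ _ (by linarith : 0 ≤ (a + b) / 2) h (by linarith)).2
      linarith
    · have := (hm _ _ (by linarith : 0 ≤ (a₁ + b₂) / 2) h (by linarith)).1
      linarith
  have hclosed : ∀ a ∈ Icc a₁ a₂, ∀ b ∈ Icc b₁ b₂, charPoint a b ∈ domain T m := by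
    intro a ⟨ha1, ha2⟩ b ⟨hb1, hb2⟩
    simp only [charPoint, domain, mem_ofPred_eq]
    refine ⟨by linarith, by linarith, by linarith, ?_⟩
    rcases le_total ((a + b) / 2) ((a₁ + b₂) / 2) with h | h
    · have := (hm _ _ (by linarith : 0 ≤ (a + b) / 2) h (by linarith)).2
      linarith
    · have := (hm _ _ (by linarith : 0 ≤ (a₁ + b₂) / 2) h (by linarith)).1
      linarith
  set X := z (charPoint a₁ b₁) + z (charPoint a₂ b₂) - z (charPoint a₁ b₂) - z (charPoint a₂ b₁)
    with hX
  -- `4 * K * ε` comes from the shrunken rectangle, and `2 * K * ε` from moving each of its four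
  -- vertices.
  have hbound : ∀ ε > 0, 4 * ε ≤ a₂ - a₁ → 4 * ε ≤ b₂ - b₁ → |X| ≤ 12 * K * ε := by
    intro ε hε h1 h2
    have hmain := abs_parallelogram_le (α₁ := a₁ + 2 * ε) (α₂ := a₂ - 2 * ε) (β₁ := b₁ + 2 * ε)
      (β₂ := b₂ - 2 * ε) hw hz hε (by linarith) (by linarith) (fun a ha b hb =>
        hopen ε hε a ⟨by linarith [ha.1], by linarith [ha.2]⟩ b
          ⟨by linarith [hb.1], by linarith [hb.2]⟩)
    have hnear : ∀ a ∈ Icc a₁ a₂, ∀ a' ∈ Icc a₁ a₂, ∀ b ∈ Icc b₁ b₂, ∀ b' ∈ Icc b₁ b₂,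
        |a - a'| ≤ 2 * ε → |b - b'| ≤ 2 * ε →
        |z (charPoint a b) - z (charPoint a' b')| ≤ 2 * K * ε := by
      intro a ha a' ha' b hb b' hb' h3 h4
      have := hz.dist_le_mul _ (hclosed a ha b hb) _ (hclosed a' ha' b' hb')
      rw [Real.dist_eq] at this
      refine this.trans ?_
      have := mul_le_mul_of_nonneg_left (dist_charPoint_le h3 h4) K.coe_nonneg
      linarith
    have ma1 : a₁ ∈ Icc a₁ a₂ := ⟨le_rfl, ha.le⟩
    have ma2 : a₂ ∈ Icc a₁ a₂ := ⟨ha.le, le_rfl⟩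
    have mb1 : b₁ ∈ Icc b₁ b₂ := ⟨le_rfl, hb.le⟩
    have mb2 : b₂ ∈ Icc b₁ b₂ := ⟨hb.le, le_rfl⟩
    have ma1' : a₁ + 2 * ε ∈ Icc a₁ a₂ := ⟨by linarith, by linarith⟩
    have ma2' : a₂ - 2 * ε ∈ Icc a₁ a₂ := ⟨by linarith, by linarith⟩
    have mb1' : b₁ + 2 * ε ∈ Icc b₁ b₂ := ⟨by linarith, by linarith⟩
    have mb2' : b₂ - 2 * ε ∈ Icc b₁ b₂ := ⟨by linarith, by linarith⟩
    have hp : ∀ r, |r - (r + 2 * ε)| ≤ 2 * ε := fun r => by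
      rw [abs_le]; constructor <;> linarith
    have hq : ∀ r, |r - (r - 2 * ε)| ≤ 2 * ε := fun r => by
      rw [abs_le]; constructor <;> linarith
    have n11 := hnear _ ma1 _ ma1' _ mb1 _ mb1' (hp _) (hp _)
    have n12 := hnear _ ma1 _ ma1' _ mb2 _ mb2' (hp _) (hq _)
    have n21 := hnear _ ma2 _ ma2' _ mb1 _ mb1' (hq _) (hp _)
    have n22 := hnear _ ma2 _ ma2' _ mb2 _ mb2' (hq _) (hq _)
    rw [abs_le] at *
    constructor <;> linarith
  have hX0 : |X| ≤ 0 := by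
    have hlim : Filter.Tendsto (fun ε : ℝ => 12 * (K : ℝ) * ε) (nhdsWithin 0 (Ioi 0)) (nhds 0) := by
      have : Filter.Tendsto (fun ε : ℝ => 12 * (K : ℝ) * ε) (nhds 0) (nhds (12 * K * 0)) :=
        (continuous_const.mul continuous_id).tendsto 0
      rw [mul_zero] at this
      exact this.mono_left nhdsWithin_le_nhds
    refine ge_of_tendsto hlim ?_
    filter_upwards [self_mem_nhdsWithin, nhdsWithin_le_nhds
      (Iio_mem_nhds (show 0 < (a₂ - a₁) / 4 by linarith)), nhdsWithin_le_nhds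
      (Iio_mem_nhds (show 0 < (b₂ - b₁) / 4 by linarith))] with ε hε h1 h2
    simp only [mem_Iio, mem_Ioi] at hε h1 h2
    exact hbound ε hε (by linarith) (by linarith)
  have := abs_nonpos_iff.1 hX0
  linarith

theorem charPoint_mem_domain_iff {T : ℝ} {m : ℝ → ℝ} {a b : ℝ} :
    charPoint a b ∈ domain T m ↔
      0 ≤ a + b ∧ a + b ≤ 2 * T ∧ a ≤ b ∧ (b - a) / 2 ≤ m ((a + b) / 2) := by
  simp only [charPoint, domain, mem_ofPred_eq]
  constructor
  · rintro ⟨h1, h2, h3, h4⟩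
    exact ⟨by linarith, by linarith, by linarith, h4⟩
  · rintro ⟨h1, h2, h3, h4⟩
    exact ⟨by linarith, by linarith, by linarith, h4⟩

theorem dAlembert_charPoint (f h : ℝ → ℝ) (a b : ℝ) :
    dAlembert f h (charPoint a b) = f a + h b := by
  simp only [dAlembert, charPoint]
  congr 2 <;> ring

namespace IsSlowFront

variable {T : ℝ} {m : ℝ → ℝ}

theorem ge_init (hm : IsSlowFront T m) {t : ℝ} (ht : t ∈ Icc 0 T) : m 0 ≤ m t :=
  (hm 0 t le_rfl ht.1 ht.2).1

theorem le_init_add (hm : IsSlowFront T m) {t : ℝ} (ht : t ∈ Icc 0 T) : m t ≤ m 0 + t := by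
  have := (hm 0 t le_rfl ht.1 ht.2).2
  linarith

theorem lipschitzOnWith (hm : IsSlowFront T m) : LipschitzOnWith 1 m (Icc 0 T) := by
  refine LipschitzOnWith.of_le_add_mul 1 fun s hs t ht => ?_
  rw [Real.dist_eq, NNReal.coe_one, one_mul]
  rcases le_total s t with h | h
  · linarith [(hm s t hs.1 h ht.2).1, abs_nonneg (s - t)]
  · linarith [(hm t s ht.1 h hs.2).2, le_abs_self (s - t)]

theorem continuousOn (hm : IsSlowFront T m) : ContinuousOn m (Icc 0 T) :=
  hm.lipschitzOnWith.continuousOn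

theorem neg_init_le (hm : IsSlowFront T m) {a b : ℝ} (h : charPoint a b ∈ domain T m) :
    -m 0 ≤ a := by
  obtain ⟨h1, h2, h3, h4⟩ := charPoint_mem_domain_iff.1 h
  have := hm.le_init_add (t := (a + b) / 2) ⟨by linarith, by linarith⟩
  linarith

/-- Going back in time along `t - x = a`, the point retreats at unit speed and the front no faster.
-/
theorem mem_domain_of_le (hm : IsSlowFront T m) {a b b' : ℝ} (h : charPoint a b ∈ domain T m)
    (h0 : 0 ≤ a + b') (hab : a ≤ b') (hb : b' ≤ b) : charPoint a b' ∈ domain T m := by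
  obtain ⟨h1, h2, h3, h4⟩ := charPoint_mem_domain_iff.1 h
  have := (hm ((a + b') / 2) ((a + b) / 2) (by linarith) (by linarith) (by linarith)).2
  exact charPoint_mem_domain_iff.2 ⟨h0, by linarith, hab, by linarith⟩

end IsSlowFront

/-! ### Consequences of Griffith's criterion for Lipschitz solutions -/

/-- Griffith's criterion forces subsonic speeds. -/
theorem lt_one_of_griffith {k v q : ℝ} (hk : 0 < k) (hv : 0 ≤ v)
    (hvG : v * (energyRelease v q - k) = 0) : v < 1 := by
  by_contra hcon
  rw [not_lt] at hcon
  rcases mul_eq_zero.1 hvG with h | h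
  · linarith
  · have : energyRelease v q ≤ 0 := by
      unfold energyRelease
      have : (1 - v ^ 2) * q ^ 2 ≤ 0 := mul_nonpos_of_nonpos_of_nonneg (by nlinarith) (sq_nonneg q)
      linarith
    linarith

/-- Griffith's criterion gives `0 ≤ m' < 1` almost everywhere, and a Lipschitz function is the
integral of its derivative. Monotonicity comes first: it keeps `m` nonnegative, where `κ` is
positive. -/
theorem IsLipschitzSolution.isSlowFront {T ℓ₀ : ℝ} {κ y₀ y₁ u m : ℝ → ℝ} {z : ℝ × ℝ → ℝ}
    (hℓ₀ : 0 < ℓ₀) (hκ : ∀ x, 0 ≤ x → 0 < κ x)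
    (h : IsLipschitzSolution T κ ℓ₀ y₀ y₁ u m z) : IsSlowFront T m := by
  obtain ⟨K, hK⟩ := h.lipschitz_front
  have hG := h.griffith_ae
  rw [ae_restrict_iff' measurableSet_Icc] at hG
  have hmono : ∀ s t, 0 ≤ s → s ≤ t → t ≤ T → m s ≤ m t := by
    intro s t hs hst ht
    refine le_of_ae_hasDerivWithinAt_nonneg hst (hK.mono (Icc_subset_Icc hs ht)) ?_
    filter_upwards [hG] with r hr hmem
    obtain ⟨v, q, hv, -, hv0, -⟩ := hr ⟨by linarith [hmem.1], by linarith [hmem.2]⟩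
    exact ⟨v, hv0, hv.hasDerivAt (Icc_mem_nhds (by linarith [hmem.1]) (by linarith [hmem.2]))⟩
  intro s t hs hst ht
  refine ⟨hmono s t hs hst ht, ?_⟩
  have hlip : LipschitzOnWith (1 + K) (fun r => r - m r) (Icc s t) :=
    (LipschitzWith.id.lipschitzOnWith).sub (hK.mono (Icc_subset_Icc hs ht))
  have := le_of_ae_hasDerivWithinAt_nonneg hst hlip ?_
  · linarith
  filter_upwards [hG] with r hr hmem
  have hr0 : 0 < r := by linarith [hmem.1]
  have hrT : r < T := by linarith [hmem.2]
  obtain ⟨v, q, hv, -, hv0, -, hvG⟩ := hr ⟨hr0.le, hrT.le⟩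
  have hm0 : 0 ≤ m r := by
    have := hmono 0 r le_rfl hr0.le hrT.le
    rw [h.initial_front] at this
    linarith
  exact ⟨1 - v, sub_nonneg.2 (lt_one_of_griffith (hκ _ hm0) hv0 hvG).le,
    (hasDerivAt_id r).sub (hv.hasDerivAt (Icc_mem_nhds hr0 hrT))⟩

/-- The strain at the front, when the displacement is a sum of the incoming wave `f (t - x)` and a
function of `t + x`, and vanishes at the front. -/
theorem front_strain_eq {T s v q p : ℝ} {m f : ℝ → ℝ} {z : ℝ × ℝ → ℝ} (hm : IsSlowFront T m)
    (hs : 0 < s) (hsT : s ≤ T) (hms : 0 < m s) (hv : HasDerivWithinAt m v (Icc 0 s) s)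
    (hq : HasDerivWithinAt (fun x => z (s, x)) q (Icc 0 (m s)) (m s))
    (hp : HasDerivAt f p (s - m s))
    (hrel : ∀ᶠ r in nhdsWithin s (Icc 0 s),
      z (s, r + m r - s) = f (s - (r + m r - s)) - f (r - m r)) :
    q * (1 + v) = -2 * p := by
  have hq' : HasDerivWithinAt (fun x => z (s, x)) q (Iic (m s)) (m s) :=
    hq.mono_of_mem_nhdsWithin (Icc_mem_nhdsLE hms)
  have hφ : HasDerivWithinAt (fun r => r + m r - s) (1 + v) (Icc 0 s) s :=
    ((hasDerivWithinAt_id s _).add hv).sub_const s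
  have hφs : s + m s - s = m s := by ring
  have h1 : HasDerivWithinAt (fun r => z (s, r + m r - s)) (q * (1 + v)) (Icc 0 s) s := by
    refine HasDerivWithinAt.comp (h₂ := fun x => z (s, x)) s (s' := Iic (m s))
      (by rwa [hφs]) hφ ?_
    intro r hr
    have := (hm r s hr.1 hr.2 hsT).1
    simp only [mem_Iic]
    linarith [hr.2]
  have h2 : HasDerivWithinAt (fun r => f (s - (r + m r - s)) - f (r - m r))
      (p * -(1 + v) - p * (1 - v)) (Icc 0 s) s := by
    refine HasDerivWithinAt.sub ?_ ?_
    · exact HasDerivAt.comp_hasDerivWithinAt (h₂ := f) s (by rwa [hφs]) (hφ.const_sub s)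
    · exact HasDerivAt.comp_hasDerivWithinAt (h₂ := f) s hp ((hasDerivWithinAt_id s _).sub hv)
  have h3 := h2.congr_of_eventuallyEq hrel (hrel.self_of_nhdsWithin ⟨hs.le, le_rfl⟩)
  have := (uniqueDiffOn_Icc hs s ⟨hs.le, le_rfl⟩).eq_deriv _ h1 h3
  rw [this]
  ring

/-! ### Uniqueness among Lipschitz solutions -/

section Uniqueness

variable {T ℓ₀ B : ℝ} {m f U : ℝ → ℝ} {z : ℝ × ℝ → ℝ} {K : NNReal}

/-- Once a weak solution is known on `{t + x ≤ B}`, it is the sum of the wave `f (t - x)` and a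
function of `t + x` on `{t - x ≤ B}`. -/
theorem sub_wave_eq (hm : IsSlowFront T m) (hw : WeakWave T m z)
    (hz : LipschitzOnWith K z (domain T m)) (hB : m 0 ≤ B)
    (hQ : ∀ p ∈ domain T m, p.1 + p.2 ≤ B → z p = dAlembert f (fun s => U s - f s) p)
    {a a' b : ℝ} (h : charPoint a b ∈ domain T m) (h' : charPoint a' b ∈ domain T m)
    (ha : a ≤ B) (ha' : a' ≤ B) :
    z (charPoint a b) - f a = z (charPoint a' b) - f a' := by
  wlog haa : a ≤ a' generalizing a a'
  · exact (this h' h ha' ha (not_le.1 haa).le).symm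
  have hQ' : ∀ a b, charPoint a b ∈ domain T m → b ≤ B →
      z (charPoint a b) = f a + (U b - f b) := fun a b hab hb => by
    rw [hQ _ hab (by simp only [charPoint]; linarith), dAlembert_charPoint]
  rcases le_total b B with hb | hb
  · rw [hQ' _ _ h hb, hQ' _ _ h' hb]
    ring
  · have hn := hm.neg_init_le h
    obtain ⟨-, -, -, h4⟩ := charPoint_mem_domain_iff.1 h
    obtain ⟨-, h2, -, -⟩ := charPoint_mem_domain_iff.1 h'
    -- Two vertices of this rectangle lie on `t + x = B`, where `hQ` applies; the other two are the
    -- points to be compared.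
    have e := parallelogram_identity hm hw hz haa hb (by linarith) h2 ha' h4
    rw [hQ' _ _ (hm.mem_domain_of_le h (by linarith) ha hb) le_rfl,
      hQ' _ _ (hm.mem_domain_of_le h' (by linarith) ha' hb) le_rfl] at e
    linarith

/-- The speed of the front at times where Griffith's criterion holds. -/
theorem front_speed_eq (hm : IsSlowFront T m) (hw : WeakWave T m z)
    (hz : LipschitzOnWith K z (domain T m)) (hm0 : 0 < m 0) (hB : m 0 ≤ B)
    (hfront : ∀ t ∈ Icc 0 T, z (t, m t) = 0) (hf : ContDiff ℝ 1 f)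
    (hQ : ∀ p ∈ domain T m, p.1 + p.2 ≤ B → z p = dAlembert f (fun s => U s - f s) p)
    {κ : ℝ → ℝ} (hκ : ∀ x, 0 ≤ x → 0 < κ x) {s : ℝ} (hs : s ∈ Ioo 0 T) (hsB : s - m s < B)
    (hG : GriffithAt T κ m z s) :
    HasDerivAt m (frontRate (deriv f (s - m s)) (κ (m s)) /
      (1 + frontRate (deriv f (s - m s)) (κ (m s)))) s := by
  obtain ⟨v, q, hv, hq, hv0, hGκ, hvG⟩ := hG
  have hms : 0 < m s := hm0.trans_le (hm.ge_init ⟨hs.1.le, hs.2.le⟩)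
  have hv' := hv.hasDerivAt (Icc_mem_nhds hs.1 hs.2)
  have hφ : ContinuousAt (fun r => r + m r - s) s :=
    (continuousAt_id.add hv'.continuousAt).sub continuousAt_const
  have hφs : s + m s - s = m s := by ring
  have hstrain := front_strain_eq hm hs.1 hs.2.le hms hv'.hasDerivWithinAt hq
    (hasDerivAt_of_contDiff_one hf _) (by
      -- The two bounds keep `x = r + m r - s` positive and the retarded time `s - x` below `B`.
      have e1 : ∀ᶠ r in nhds s, r + m r - s ∈ Ioi (max 0 (s - B)) := by
        refine hφ.eventually (Ioi_mem_nhds ?_)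
        show max 0 (s - B) < s + m s - s
        rw [hφs]
        exact max_lt hms (by linarith)
      filter_upwards [nhdsWithin_le_nhds e1, self_mem_nhdsWithin] with r hr hmem
      have hr0 : 0 < r + m r - s := (le_max_left _ _).trans_lt hr
      have hrB : s - B < r + m r - s := (le_max_right _ _).trans_lt hr
      obtain ⟨g1, g2⟩ := hm r s hmem.1 hmem.2 hs.2.le
      have hrT : r ∈ Icc 0 T := ⟨hmem.1, hmem.2.trans hs.2.le⟩
      have hmr := hm.ge_init hrT
      have p1 : charPoint (s - (r + m r - s)) (r + m r) = (s, r + m r - s) := by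
        ext <;> simp only [charPoint] <;> ring
      have p2 : charPoint (r - m r) (r + m r) = (r, m r) := by
        ext <;> simp only [charPoint] <;> ring
      have key := sub_wave_eq (a := s - (r + m r - s)) (a' := r - m r) (b := r + m r)
        hm hw hz hB hQ ?_ ?_ (by linarith) (by linarith)
      · rw [p1, p2, hfront r hrT] at key
        linarith
      · rw [p1]
        exact ⟨hs.1.le, hs.2.le, hr0.le, by simp only; linarith [hmem.2]⟩
      · rw [p2]
        exact ⟨hrT.1, hrT.2, by simp only; linarith, le_rfl⟩)
  rw [← eq_frontRate_div_of_griffith (hκ _ hms.le) hv0 hstrain hGκ hvG]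
  exact hv'

/-- The front is determined by the incoming wave. -/
theorem front_eq_frontCurve (hm : IsSlowFront T m) (hw : WeakWave T m z)
    (hz : LipschitzOnWith K z (domain T m)) (hm0 : m 0 = ℓ₀) (hℓ₀ : 0 < ℓ₀) (hB : ℓ₀ ≤ B)
    (hfront : ∀ t ∈ Icc 0 T, z (t, m t) = 0) (hf : ContDiff ℝ 1 f)
    (hQ : ∀ p ∈ domain T m, p.1 + p.2 ≤ B → z p = dAlembert f (fun s => U s - f s) p)
    {κ k lam lam' : ℝ → ℝ} {L : NNReal} {c : ℝ} (hc : 0 < c) (hκ : ∀ x, 0 ≤ x → 0 < κ x)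
    (hk : LipschitzWith L k) (hck : ∀ x, c ≤ k x) (hkκ : ∀ x ∈ Icc ℓ₀ (ℓ₀ + T), k x = κ x)
    (hlam : IsFrontCurve T ℓ₀ k (deriv f) lam lam')
    (hG : ∀ᵐ t, t ∈ Icc 0 T → GriffithAt T κ m z t) {t : ℝ} (ht : t ∈ Icc 0 T)
    (htB : t - m t < B) : m t = lam (t - m t) := by
  have hT : 0 ≤ T := ht.1.trans ht.2
  have hdf := continuous_deriv_of_contDiff_one hf
  obtain ⟨n, hn, hnm⟩ := exists_continuous_extension hT hm.continuousOn
  set V : ℝ → ℝ := fun s => frontRate (deriv f (s - n s)) (k (n s)) with hVdef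
  have hV0 : ∀ s, 0 ≤ V s := fun s => frontRate_nonneg _ _
  have hVc : Continuous V := by
    refine Continuous.max (Continuous.sub (Continuous.div ?_ (hk.continuous.comp hn) ?_)
      continuous_const) continuous_const
    · exact (hdf.comp (continuous_id.sub hn)).pow 2
    · exact fun s => (hc.trans_le (hck _)).ne'
  set g : ℝ → ℝ := fun s => V s / (1 + V s) with hgdef
  have hgc : Continuous g := hVc.div (continuous_const.add hVc) fun s => by linarith [hV0 s]
  have hg1 : ∀ s, 1 - g s = 1 / (1 + V s) := fun s => by
    have : 1 + V s ≠ 0 := by linarith [hV0 s]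
    simp only [hgdef]
    field_simp
    ring
  have hgV : ∀ s, g s = (1 - g s) * V s := fun s => by
    rw [hg1]
    simp only [hgdef]
    ring
  have hrange : ∀ s ∈ Icc 0 T, m s ∈ Icc ℓ₀ (ℓ₀ + T) := fun s hs => by
    have h1 := hm.ge_init hs
    have h2 := hm.le_init_add hs
    rw [hm0] at h1 h2
    exact ⟨h1, by linarith [hs.2]⟩
  have hM := hasDerivAt_const_add_integral hgc ℓ₀ 0
  set M : ℝ → ℝ := fun s => ℓ₀ + ∫ r in (0 : ℝ)..s, g r with hMdef
  -- The almost everywhere speed is the continuous `g`, so the front is a `C^1` primitive on `[0,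
  -- t]`, to which Grönwall applies.
  have hmM : ∀ s ∈ Icc 0 t, m s = M s := by
    intro s hs
    have hsT : s ≤ T := hs.2.trans ht.2
    have := eq_integral_of_ae_hasDerivAt (g := g) hs.1
      (hm.lipschitzOnWith.mono (Icc_subset_Icc_right hsT)) (by
        filter_upwards [hG] with r hr hmem
        have hrT : r < T := hmem.2.trans_le hsT
        have hrI : r ∈ Icc 0 T := ⟨hmem.1.le, hrT.le⟩
        have hrB : r - m r < B := by
          have := (hm r t hmem.1.le (hmem.2.le.trans hs.2) ht.2).2
          linarith
        have := front_speed_eq hm hw hz (by rwa [hm0]) (by rwa [hm0]) hfront hf hQ hκ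
          ⟨hmem.1, hrT⟩ hrB (hr hrI)
        simp only [hgdef, hVdef, hnm hrI, hkκ _ (hrange r hrI)]
        exact this)
    simp only [hMdef]
    linarith
  obtain ⟨P, hP⟩ := isCompact_Icc.exists_bound_of_continuousOn (s := Icc (-ℓ₀) T) hdf.continuousOn
  simp only [Real.norm_eq_abs] at hP
  -- The derivative factors as `(1 - g s) * (V s - lam' (s - M s))`. Both rates see the same `deriv
  -- f (s - M s)`, so their difference is controlled by `|M s - lam (s - M s)|`.
  have hzero := eq_zero_of_abs_deriv_le_mul_abs_self_of_eq_zero_right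
    (f := fun s => M s - lam (s - M s)) (f' := fun s => g s - lam' (s - M s) * (1 - g s))
    (K := P ^ 2 / c ^ 2 * L) (a := 0) (b := t) ?_ (fun s _ => ?_) ?_ (fun s hs => ?_) t
    ⟨ht.1, le_rfl⟩
  · rw [← hmM t ⟨ht.1, le_rfl⟩] at hzero
    linarith
  · have hMc : Continuous M := continuous_iff_continuousAt.2 fun s => (hM s).continuousAt
    exact (hMc.sub (hlam.continuous.comp (continuous_id.sub hMc))).continuousOn
  · exact ((hM s).sub ((hlam.hasDerivAt _).comp s
      ((hasDerivAt_id s).sub (hM s)))).hasDerivWithinAt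
  · simp [hMdef, hlam.init]
  · have hsI : s ∈ Icc 0 T := ⟨hs.1, hs.2.le.trans ht.2⟩
    have hms := hmM s (Ico_subset_Icc_self hs)
    have hr := hrange s hsI
    have hσ : s - M s ∈ Icc (-ℓ₀) T := by
      rw [← hms]
      have := hm.le_init_add hsI
      rw [hm0] at this
      exact ⟨by linarith, by linarith [hsI.2, hr.1]⟩
    have hVs : V s = frontRate (deriv f (s - M s)) (k (M s)) := by
      simp only [hVdef, hnm hsI, hms]
    have e : g s - lam' (s - M s) * (1 - g s) = (1 - g s) * (V s - lam' (s - M s)) := by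
      linear_combination hgV s
    have h1 : |1 - g s| ≤ 1 := by
      rw [hg1, abs_of_nonneg (div_nonneg zero_le_one (by linarith [hV0 s])),
        div_le_one (by linarith [hV0 s])]
      linarith [hV0 s]
    rw [e, norm_mul, Real.norm_eq_abs, Real.norm_eq_abs, hlam.eq _ hσ, hVs]
    refine (mul_le_of_le_one_left (abs_nonneg _) h1).trans ?_
    refine (abs_frontRate_sub_le hc (hck _) (hck _) (hP _ hσ)).trans ?_
    rw [mul_assoc]
    exact mul_le_mul_of_nonneg_left (hk.dist_le_mul _ _) (by positivity)

/-- The dependence region of the initial data. -/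
theorem eq_dAlembert_of_initial (hm : IsSlowFront T m) (hw : WeakWave T m z)
    (hz : LipschitzOnWith K z (domain T m)) (hm0 : m 0 = ℓ₀) (hℓ₀ : 0 < ℓ₀)
    (hf : ContDiff ℝ 1 f) (hU : ContDiff ℝ 1 U) (hleft : ∀ t ∈ Icc 0 T, z (t, 0) = U t)
    (hinit : ∀ x ∈ Icc 0 ℓ₀, z (0, x) = dAlembert f (fun s => U s - f s) (0, x)) {y₁ : ℝ → ℝ}
    (hvel : ∀ᵐ x, x ∈ Icc 0 ℓ₀ → HasDerivWithinAt (fun t => z (t, x)) (y₁ x) (Icc 0 T) 0)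
    (hvel' : ∀ x ∈ Icc 0 ℓ₀,
      HasDerivAt (fun t => dAlembert f (fun s => U s - f s) (t, x)) (y₁ x) 0) :
    ∀ p ∈ domain T m, p.1 + p.2 ≤ ℓ₀ → z p = dAlembert f (fun s => U s - f s) p := by
  set Y := dAlembert f (fun s => U s - f s) with hY
  have hYc : ∀ a b, Y (charPoint a b) = f a + (U b - f b) := fun a b => dAlembert_charPoint _ _ _ _
  have hge : ∀ t ∈ Icc 0 T, ℓ₀ ≤ m t := fun t ht => hm0 ▸ hm.ge_init ht
  have hneg : ∀ a b, a ≤ 0 → b ≤ ℓ₀ → 0 ≤ a + b → a + b ≤ 2 * T →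
      z (charPoint a b) = Y (charPoint a b) := by
    intro a₀ b₀ ha₀ hb₀ h0 h2T
    set q : ℝ → ℝ := fun b => z (charPoint a₀ b) - (f a₀ + (U b - f b)) with hq
    have hmem : ∀ a b, a ≤ a₀ → b ≤ b₀ → 0 ≤ a + b → charPoint a b ∈ domain T m := by
      intro a b ha hb hab
      have := hge ((a + b) / 2) ⟨by linarith, by linarith⟩
      exact charPoint_mem_domain_iff.2 ⟨hab, by linarith, by linarith, by linarith⟩
    have hrect : ∀ a b, a ≤ a₀ → b ≤ b₀ → 0 ≤ a + b →
        z (charPoint a b) + z (charPoint a₀ b₀) = z (charPoint a b₀) + z (charPoint a₀ b) := by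
      intro a b ha hb hab
      have := hge ((a + b₀) / 2) ⟨by linarith, by linarith⟩
      exact parallelogram_identity hm hw hz ha hb hab h2T (by linarith) (by linarith)
    have hinit' : ∀ b ∈ Icc 0 ℓ₀, z (charPoint (-b) b) = f (-b) + (U b - f b) := by
      intro b hb
      have : charPoint (-b) b = (0, b) := by ext <;> simp [charPoint]
      rw [← hYc, this]
      exact hinit b hb
    -- Comparing the rectangles at `(a, b)` and at the initial point `(a, -a)` writes the error `z -
    -- Y` through its trace `q` on `t - x = a₀`.
    have hW : ∀ a b, a ≤ a₀ → b ≤ b₀ → 0 ≤ a + b →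
        z (charPoint a b) - Y (charPoint a b) = q b - q (-a) := by
      intro a b ha hb hab
      have h1 := hrect a b ha hb hab
      have h2 := hrect a (-a) ha (by linarith) (by linarith)
      have h3 := hinit' (-a) ⟨by linarith, by linarith⟩
      rw [neg_neg] at h3
      rw [h3] at h2
      rw [hYc]
      simp only [hq]
      linarith
    obtain ⟨K', hK'⟩ := ((contDiff_const (c := f a₀)).add (hU.sub hf)).contDiffOn
      (s := Icc (-a₀) b₀) |>.exists_lipschitzOnWith one_ne_zero (convex_Icc _ _) isCompact_Icc
    have hqlip : LipschitzOnWith (K * 1 + K') q (Icc (-a₀) b₀) := by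
      refine LipschitzOnWith.sub (hz.comp (f := fun b => charPoint a₀ b) ?_ ?_) hK'
      · refine LipschitzOnWith.of_dist_le_mul fun b _ b' _ => ?_
        rw [NNReal.coe_one, one_mul]
        exact dist_charPoint_le (by simp) (Real.dist_eq b b').ge
      · intro b hb
        exact hmem a₀ b le_rfl hb.2 (by linarith [hb.1])
    have hJ : -a₀ ≤ b₀ := by linarith
    have hac : AbsolutelyContinuousOnInterval q (-a₀) b₀ :=
      LipschitzOnWith.absolutelyContinuousOnInterval (by rwa [uIcc_of_le hJ])
    -- At `t = 0` the error `q (t + x) - q (x - t)` has time derivative `2 * deriv q x`, which the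
    -- initial velocity forces to vanish for almost every `x`; the Lipschitz `q` is then constant.
    have hconst := eq_integral_of_ae_hasDerivAt (g := fun _ => 0) hJ hqlip (by
      filter_upwards [hvel, hac.ae_differentiableAt] with x hx hdx hmemx
      have hxI : x ∈ Icc 0 ℓ₀ := ⟨by linarith [hmemx.1], by linarith [hmemx.2]⟩
      have hd := (hdx (by rw [uIcc_of_le hJ]; exact Ioo_subset_Icc_self hmemx)).hasDerivAt
      have hTpos : 0 < T := by linarith [hmemx.1, hmemx.2]
      have d1 : HasDerivWithinAt (fun t => z (t, x) - Y (t, x)) 0 (Icc 0 T) 0 :=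
        ((hx hxI).sub (hvel' x hxI).hasDerivWithinAt).congr_deriv (sub_self _)
      have d2 : HasDerivWithinAt (fun t => q (t + x) - q (x - t)) (2 * deriv q x) (Icc 0 T) 0 := by
        have e1 : HasDerivAt (fun t => q (t + x)) (deriv q x) 0 :=
          HasDerivAt.comp_add_const 0 x (by simpa using hd)
        have e2 : HasDerivAt (fun t => q (x - t)) (-deriv q x) 0 :=
          HasDerivAt.comp_const_sub x 0 (by simpa using hd)
        have := (e1.sub e2).hasDerivWithinAt (s := Icc 0 T)
        convert! this using 1
        ring
      have hev : (fun t => z (t, x) - Y (t, x)) =ᶠ[nhdsWithin 0 (Icc 0 T)]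
          fun t => q (t + x) - q (x - t) := by
        filter_upwards [self_mem_nhdsWithin, nhdsWithin_le_nhds
          (Iio_mem_nhds (show 0 < a₀ + x by linarith [hmemx.1])), nhdsWithin_le_nhds
          (Iio_mem_nhds (show 0 < b₀ - x by linarith [hmemx.2]))] with t ht ht1 ht2
        simp only [mem_Iio] at ht1 ht2
        have := hW (t - x) (t + x) (by linarith) (by linarith) (by linarith [ht.1])
        have hc : charPoint (t - x) (t + x) = (t, x) := charPoint_sub_add (t, x)
        rw [hc] at this
        rw [this, neg_sub]
      have d3 := d2.congr_of_eventuallyEq hev (hev.self_of_nhdsWithin ⟨le_rfl, hTpos.le⟩)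
      have hu := (uniqueDiffOn_Icc hTpos 0 ⟨le_rfl, hTpos.le⟩).eq_deriv _ d1 d3
      have hz0 : deriv q x = 0 := by linarith
      rwa [hz0] at hd)
    have := hW a₀ b₀ le_rfl le_rfl h0
    simp only [intervalIntegral.integral_zero] at hconst
    linarith
  intro p hp hpb
  rw [← charPoint_sub_add p] at hp ⊢
  set a := p.1 - p.2
  set b := p.1 + p.2
  obtain ⟨h1, h2, h3, h4⟩ := charPoint_mem_domain_iff.1 hp
  rcases le_or_gt a 0 with ha | ha
  · exact hneg a b ha hpb h1 h2
  -- For `a > 0` the vertex `(a, a)` lies on `x = 0`, and two others have `t - x = 0`, already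
  -- treated.
  · have e := parallelogram_identity (a₁ := 0) (a₂ := a) (b₁ := a) (b₂ := b) hm hw hz ha.le h3
      (by linarith) h2 le_rfl (by
        have := hge ((0 + b) / 2) ⟨by linarith, by linarith⟩
        linarith)
    rw [hneg 0 a le_rfl (by linarith) (by linarith) (by linarith),
      hneg 0 b le_rfl hpb (by linarith) (by linarith)] at e
    have hd : charPoint a a = (a, 0) := by ext <;> simp [charPoint]
    rw [hd, hleft a ⟨ha.le, by linarith⟩, hYc, hYc] at e
    rw [hYc]
    linarith

/-- Uniqueness of the front and of the displacement. -/
theorem front_and_displacement_unique (hm : IsSlowFront T m) (hw : WeakWave T m z)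
    (hz : LipschitzOnWith K z (domain T m)) (hm0 : m 0 = ℓ₀) (hℓ₀ : 0 < ℓ₀)
    (hfront : ∀ t ∈ Icc 0 T, z (t, m t) = 0) (hleft : ∀ t ∈ Icc 0 T, z (t, 0) = U t)
    (hf : ContDiff ℝ 1 f)
    (hbase : ∀ p ∈ domain T m, p.1 + p.2 ≤ ℓ₀ → z p = dAlembert f (fun s => U s - f s) p)
    {κ k lam lam' : ℝ → ℝ} {L : NNReal} {c : ℝ} (hc : 0 < c) (hκ : ∀ x, 0 ≤ x → 0 < κ x)
    (hk : LipschitzWith L k) (hck : ∀ x, c ≤ k x) (hkκ : ∀ x ∈ Icc ℓ₀ (ℓ₀ + T), k x = κ x)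
    (hlam : IsFrontCurve T ℓ₀ k (deriv f) lam lam')
    (href : ∀ s ∈ Icc (-ℓ₀) T, f (s + 2 * lam s) = U (s + 2 * lam s) + f s)
    (hG : ∀ᵐ t, t ∈ Icc 0 T → GriffithAt T κ m z t) :
    (∀ t ∈ Icc 0 T, m t = lam (t - m t)) ∧
      ∀ p ∈ domain T m, z p = dAlembert f (fun s => U s - f s) p := by
  set Y := dAlembert f (fun s => U s - f s) with hY
  have hYc : ∀ a b, Y (charPoint a b) = f a + (U b - f b) := fun a b => dAlembert_charPoint _ _ _ _
  have hge : ∀ t ∈ Icc 0 T, ℓ₀ ≤ m t := fun t ht => hm0 ▸ hm.ge_init ht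
  have hstep : ∀ B, ℓ₀ ≤ B → (∀ p ∈ domain T m, p.1 + p.2 ≤ B → z p = Y p) →
      ∀ p ∈ domain T m, p.1 + p.2 ≤ B + ℓ₀ → z p = Y p := by
    intro B hB hQ
    -- Passing the front: the characteristic `t + x = b` is followed back to the front, where `z =
    -- 0`, and the reflection law evaluates `f` there.
    have hlow : ∀ a b, charPoint a b ∈ domain T m → a < B →
        z (charPoint a b) = Y (charPoint a b) := by
      intro a b hab ha
      rcases le_or_gt b B with hb | hb
      · exact hQ _ hab (by simp only [charPoint]; linarith)
      obtain ⟨h1, h2, h3, h4⟩ := charPoint_mem_domain_iff.1 hab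
      have hivt := intermediate_value_Icc (f := fun t => t + m t) (a := 0) (b := (a + b) / 2)
        (by linarith) (continuousOn_id.add (hm.continuousOn.mono
          (Icc_subset_Icc_right (by linarith))))
      obtain ⟨t, ht, htb⟩ := hivt (show b ∈ Icc (0 + m 0) ((a + b) / 2 + m ((a + b) / 2)) from
        ⟨by linarith, by linarith⟩)
      simp only at htb
      have htT : t ∈ Icc 0 T := ⟨ht.1, by linarith [ht.2]⟩
      have hta : t - m t ≤ a := by linarith [ht.2]
      have hc0 : charPoint (t - m t) b = (t, m t) := by
        rw [← htb]
        exact charPoint_sub_add (t, m t)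
      have key := sub_wave_eq hm hw hz (hm0.le.trans hB) hQ hab (a' := t - m t)
        (by rw [hc0]; exact ⟨htT.1, htT.2, by linarith [hge t htT], le_rfl⟩) ha.le (by linarith)
      rw [hc0, hfront t htT] at key
      have hl := front_eq_frontCurve hm hw hz hm0 hℓ₀ hB hfront hf hQ hc hκ hk hck hkκ hlam hG htT
        (by linarith)
      have hr := href (t - m t) ⟨by linarith [hm.le_init_add htT], by linarith [hge t htT, htT.2]⟩
      rw [← hl, show t - m t + 2 * m t = b by linarith] at hr
      rw [hYc]
      linarith
    intro p hp hpb
    rw [← charPoint_sub_add p] at hp ⊢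
    set a := p.1 - p.2
    set b := p.1 + p.2
    rcases lt_or_ge a B with ha | ha
    · exact hlow a b hp ha
    obtain ⟨h1, h2, h3, h4⟩ := charPoint_mem_domain_iff.1 hp
    -- Since `b ≤ B + ℓ₀`, this corner has `x ≤ ℓ₀` and so lies below the front. The choice `B - ℓ₀`
    -- is what limits the gain to `ℓ₀`.
    have hfr : (b - (B - ℓ₀)) / 2 ≤ m ((B - ℓ₀ + b) / 2) := by
      have := hge ((B - ℓ₀ + b) / 2) ⟨by linarith, by linarith⟩
      linarith
    have e := parallelogram_identity (a₁ := B - ℓ₀) (a₂ := a) (b₁ := a) (b₂ := b) hm hw hz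
      (by linarith) h3 (by linarith) h2 le_rfl hfr
    have hmem : charPoint (B - ℓ₀) b ∈ domain T m :=
      charPoint_mem_domain_iff.2 ⟨by linarith, by linarith, by linarith, hfr⟩
    rw [hlow (B - ℓ₀) a (hm.mem_domain_of_le hmem (by linarith) (by linarith) h3) (by linarith),
      hlow (B - ℓ₀) b hmem (by linarith)] at e
    have hd : charPoint a a = (a, 0) := by ext <;> simp [charPoint]
    rw [hd, hleft a ⟨by linarith, by linarith⟩, hYc, hYc] at e
    rw [hYc]
    linarith
  have hall : ∀ n : ℕ, ∀ p ∈ domain T m, p.1 + p.2 ≤ ℓ₀ + n * ℓ₀ → z p = Y p := by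
    intro n
    induction n with
    | zero => simpa using hbase
    | succ n ih =>
      have := hstep (ℓ₀ + n * ℓ₀) (le_add_of_nonneg_right (by positivity)) ih
      push_cast
      rw [add_mul, one_mul, ← add_assoc]
      exact this
  obtain ⟨n, hn⟩ := exists_nat_ge ((2 * T + ℓ₀) / ℓ₀)
  rw [div_le_iff₀ hℓ₀] at hn
  refine ⟨fun t ht => ?_, fun p hp => hall n p hp ?_⟩
  · have hT : 0 ≤ T := ht.1.trans ht.2
    exact front_eq_frontCurve hm hw hz hm0 hℓ₀ (le_add_of_nonneg_right (by positivity)) hfront hf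
      (hall n) hc hκ hk hck hkκ hlam hG ht (by linarith [hge t ht, ht.2])
  · have := hm.le_init_add ⟨hp.1, hp.2.1⟩
    linarith [hp.2.1, hp.2.2.2]

end Uniqueness

/-! ### The representative function and the initial profile -/

theorem deriv_eq_of_eqOn {f g : ℝ → ℝ} {s : Set ℝ} (hf : ContDiff ℝ 1 f) (hg : ContDiff ℝ 1 g)
    (hs : UniqueDiffOn ℝ s) (h : EqOn f g s) {x : ℝ} (hx : x ∈ s) : deriv f x = deriv g x :=
  (hs x hx).eq_deriv _ (hasDerivAt_of_contDiff_one hf x).hasDerivWithinAt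
    ((hasDerivAt_of_contDiff_one hg x).hasDerivWithinAt.congr h (h hx))

/-- The representative function of a front is unique. -/
theorem IsRepresentative.eqOn {T ℓ₀ : ℝ} {y₀ y₁ u ℓ f g : ℝ → ℝ} (hℓ₀ : 0 < ℓ₀)
    (hℓ : IsSlowFront T ℓ) (hℓ0 : ℓ 0 = ℓ₀) (hf : IsRepresentative T ℓ₀ y₀ y₁ u ℓ f)
    (hg : IsRepresentative T ℓ₀ y₀ y₁ u ℓ g) : EqOn g f (Icc (-ℓ₀) T) := by
  -- The reflection law goes back from `s` to `s - 2 * ℓ t`, by more than the step `ℓ₀` of the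
  -- induction.
  have key : ∀ n : ℕ, ∀ s ∈ Icc (-ℓ₀) T, s ≤ ℓ₀ + n * ℓ₀ → g s = f s := by
    intro n
    have hbase : ∀ s ∈ Icc (-ℓ₀) T, s ≤ ℓ₀ → g s = f s := by
      intro s hs hsℓ
      rcases le_or_gt s 0 with h | h
      · rw [hg.initial s ⟨hs.1, h⟩, hf.initial s ⟨hs.1, h⟩]
      · rw [hg.control s ⟨h, hsℓ⟩ hs.2, hf.control s ⟨h, hsℓ⟩ hs.2]
    induction n with
    | zero => simpa using hbase
    | succ n ih =>
      intro s hs hsn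
      rcases le_or_gt s ℓ₀ with h | h
      · exact hbase s hs h
      have hsT := hs.2
      have hT : T ∈ Icc 0 T := ⟨by linarith, le_rfl⟩
      have hivt := intermediate_value_Icc (f := fun t => t + ℓ t) hT.1
        (continuousOn_id.add hℓ.continuousOn)
      have hℓT := hℓ.ge_init hT
      obtain ⟨t, ht, hts⟩ := hivt (show s ∈ Icc (0 + ℓ 0) (T + ℓ T) from
        ⟨by linarith, by linarith⟩)
      simp only at hts
      have ht0 : 0 < t := by
        rcases ht.1.eq_or_lt with rfl | h0
        · linarith
        · exact h0
      have hge := hℓ.ge_init ht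
      have hle := hℓ.le_init_add ht
      rw [← hts, hg.reflection t ht0 (by linarith) ht.2, hf.reflection t ht0 (by linarith) ht.2,
        ih (t - ℓ t) ⟨by linarith, by linarith [ht.2]⟩ (by push_cast at hsn; linarith)]
  intro s hs
  obtain ⟨n, hn⟩ := exists_nat_ge (T / ℓ₀)
  rw [div_le_iff₀ hℓ₀] at hn
  exact key n s hs (by linarith [hs.2])

theorem integral_comp_neg_hasDerivAt {G : ℝ → ℝ} (hG : Continuous G) (s : ℝ) :
    HasDerivAt (fun s => 1 / 2 * ∫ σ in (0 : ℝ)..(-s), G σ) (-(1 / 2 * G (-s))) s := by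
  have h1 : HasDerivAt (fun r => ∫ σ in (0 : ℝ)..r, G σ) (G (-s)) (-s) := by
    simpa using hasDerivAt_const_add_integral hG 0 0 (-s)
  have h2 := (h1.comp s (hasDerivAt_neg s)).const_mul (1 / 2)
  exact h2.congr_deriv (by ring)

/-- The part of the profile `f` that is determined by the initial data: `f₀` is `C^1` and satisfies
the reflection law at `ℓ₀` to first order. -/
theorem exists_initial_profile {ℓ₀ k₀ : ℝ} {D E U : ℝ → ℝ} (hℓ₀ : 0 < ℓ₀) (hk₀ : 0 < k₀)
    (hD : Continuous D) (hE : Continuous E) (hU : ContDiff ℝ 1 U)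
    (h0 : E 0 = deriv U 0) (hint : ∫ σ in (0 : ℝ)..ℓ₀, D σ = -U 0)
    (hℓ : E ℓ₀ = -frontSpeed (E ℓ₀ - D ℓ₀) k₀ * D ℓ₀) :
    ∃ f₀ : ℝ → ℝ, ContDiff ℝ 1 f₀ ∧
      (∀ s ≤ 0, f₀ s = 1 / 2 * ∫ σ in (0 : ℝ)..(-s), (D σ - E σ)) ∧
      (∀ s, 0 ≤ s → f₀ s = U s - U 0 - 1 / 2 * ∫ σ in (0 : ℝ)..s, (D σ + E σ)) ∧
      (∀ s ≤ 0, deriv f₀ s = -(1 / 2 * (D (-s) - E (-s)))) ∧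
      (∀ s, 0 ≤ s → deriv f₀ s = deriv U s - 1 / 2 * (D s + E s)) ∧
      f₀ ℓ₀ = U ℓ₀ + f₀ (-ℓ₀) ∧
      deriv f₀ ℓ₀ = deriv U ℓ₀ +
        deriv f₀ (-ℓ₀) / (1 + 2 * frontRate (deriv f₀ (-ℓ₀)) k₀) := by
  have hL : ∀ s, HasDerivAt (fun s => 1 / 2 * ∫ σ in (0 : ℝ)..(-s), (D σ - E σ))
      (-(1 / 2 * (D (-s) - E (-s)))) s := integral_comp_neg_hasDerivAt (hD.sub hE)
  have hR : ∀ s, HasDerivAt (fun s => U s - U 0 - 1 / 2 * ∫ σ in (0 : ℝ)..s, (D σ + E σ))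
      (deriv U s - 1 / 2 * (D s + E s)) s := by
    intro s
    have h1 : HasDerivAt (fun r => ∫ σ in (0 : ℝ)..r, (D σ + E σ)) (D s + E s) s := by
      simpa using hasDerivAt_const_add_integral (hD.add hE) 0 0 s
    exact ((hasDerivAt_of_contDiff_one hU s).sub_const _).sub (h1.const_mul _)
  set fL : ℝ → ℝ := fun s => 1 / 2 * ∫ σ in (0 : ℝ)..(-s), (D σ - E σ) with hfL
  set fR : ℝ → ℝ := fun s => U s - U 0 - 1 / 2 * ∫ σ in (0 : ℝ)..s, (D σ + E σ) with hfR
  have cL : ContDiff ℝ 1 fL := contDiff_one_of_hasDerivAt hL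
    (continuous_const.mul ((hD.sub hE).comp continuous_neg)).neg
  have cR : ContDiff ℝ 1 fR := contDiff_one_of_hasDerivAt hR
    ((continuous_deriv_of_contDiff_one hU).sub (continuous_const.mul (hD.add hE)))
  have e0 : fL 0 = fR 0 := by simp [hfL, hfR]
  have e1 : deriv fL 0 = deriv fR 0 := by
    rw [(hL 0).deriv, (hR 0).deriv, neg_zero, ← h0]
    ring
  set f₀ : ℝ → ℝ := fun s => if s ≤ 0 then fL s else fR s with hf₀
  have c0 : ContDiff ℝ 1 f₀ := contDiff_one_glue cL cR e0 e1
  have hl : EqOn f₀ fL (Iic 0) := fun s hs => if_pos hs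
  have hr : EqOn f₀ fR (Ici 0) := fun s hs => by
    rcases (show (0 : ℝ) ≤ s from hs).eq_or_lt with rfl | h
    · rw [← e0]
      exact if_pos le_rfl
    · exact if_neg (not_le.2 h)
  have hdl : ∀ s ≤ 0, deriv f₀ s = -(1 / 2 * (D (-s) - E (-s))) := fun s hs =>
    (deriv_eq_of_eqOn c0 cL (uniqueDiffOn_Iic 0) hl hs).trans (hL s).deriv
  have hdr : ∀ s, 0 ≤ s → deriv f₀ s = deriv U s - 1 / 2 * (D s + E s) := fun s hs =>
    (deriv_eq_of_eqOn c0 cR (uniqueDiffOn_Ici 0) hr hs).trans (hR s).deriv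
  refine ⟨f₀, c0, hl, hr, hdl, hdr, ?_, ?_⟩
  · rw [hr hℓ₀.le, hl (show -ℓ₀ ≤ 0 by linarith)]
    simp only [hfR, hfL, neg_neg]
    rw [intervalIntegral.integral_add (hD.intervalIntegrable _ _) (hE.intervalIntegrable _ _),
      intervalIntegral.integral_sub (hD.intervalIntegrable _ _) (hE.intervalIntegrable _ _), hint]
    ring
  · rw [hdr ℓ₀ hℓ₀.le, hdl (-ℓ₀) (by linarith), neg_neg]
    -- `p` is the slope of `f₀` at `-ℓ₀`. The compatibility condition becomes `E ℓ₀ * (1 + Λ) = -Λ *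
    -- D ℓ₀`, and hence `p / (1 + 2 * Λ)` is the required jump `-(D ℓ₀ + E ℓ₀) / 2`.
    set p := -(1 / 2 * (D ℓ₀ - E ℓ₀)) with hp
    have hp2 : E ℓ₀ - D ℓ₀ = 2 * p := by rw [hp]; ring
    rw [hp2, frontSpeed_eq_div hk₀] at hℓ
    have hΛ := frontRate_nonneg p k₀
    set Λ := frontRate p k₀
    have h2 : E ℓ₀ * (1 + Λ) = -Λ * D ℓ₀ := by
      rw [hℓ]
      field_simp
    have h3 : p * (1 + Λ) = -(1 / 2) * D ℓ₀ * (1 + 2 * Λ) := by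
      linear_combination (-(1 + Λ) / 2) * hp2 + (1 / 2) * h2
    have h4 : p / (1 + 2 * Λ) = -(1 / 2 * (D ℓ₀ + E ℓ₀)) := by
      rw [div_eq_iff (by linarith)]
      refine mul_right_cancel₀ (show 1 + Λ ≠ 0 by linarith) ?_
      rw [h3]
      linear_combination (1 / 2 * (1 + 2 * Λ)) * h2
    rw [h4]
    ring

/-! ### From the profile and the front curve to a classical solution -/

/-- A locally Lipschitz toughness, frozen outside a compact interval. -/
theorem exists_lipschitz_toughness {κ : ℝ → ℝ} {c₁ c₂ a b : ℝ} (ha : 0 ≤ a) (hab : a ≤ b)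
    (hκ : ∀ x, 0 ≤ x → κ x ∈ Icc c₁ c₂) (hκLip : LocallyLipschitzOn (Ici 0) κ) :
    ∃ (k : ℝ → ℝ) (L : NNReal), LipschitzWith L k ∧ (∀ x, c₁ ≤ k x) ∧ EqOn k κ (Icc a b) := by
  have hsub : Icc a b ⊆ Ici 0 := fun x hx => ha.trans hx.1
  obtain ⟨L, hL⟩ := (hκLip.mono hsub).exists_lipschitzOnWith_of_compact isCompact_Icc
  refine ⟨fun x => κ (projIcc a b hab x), L * 1, ?_, fun x => ?_, fun x hx => ?_⟩
  · rw [← lipschitzOnWith_univ]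
    refine hL.comp (f := fun x => (projIcc a b hab x : ℝ)) ?_ fun x _ => (projIcc a b hab x).2
    exact ((LipschitzWith.subtype_val _).comp (LipschitzWith.projIcc hab)).lipschitzOnWith.weaken
      (by simp)
  · exact (hκ _ (hsub (projIcc a b hab x).2)).1
  · simp only
    rw [projIcc_of_mem hab hx]

/-- The front in the time variable, obtained from the front curve in the retarded time. -/
theorem IsFrontCurve.exists_front {T ℓ₀ : ℝ} {k p lam lam' : ℝ → ℝ} (hℓ₀ : 0 < ℓ₀)
    (h : IsFrontCurve T ℓ₀ k p lam lam') :
    ∃ ℓ : ℝ → ℝ, ContDiff ℝ 1 ℓ ∧ ℓ 0 = ℓ₀ ∧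
      (∀ t ∈ Icc 0 T, t - ℓ t ∈ Icc (-ℓ₀) T ∧ ℓ t = lam (t - ℓ t) ∧ ℓ t ∈ Icc ℓ₀ (ℓ₀ + T) ∧
        HasDerivAt ℓ (frontRate (p (t - ℓ t)) (k (ℓ t)) /
          (1 + frontRate (p (t - ℓ t)) (k (ℓ t)))) t) ∧
      ∀ t x, x = lam (t - x) → x = ℓ t := by
  -- Physical time is `t = σ + lam σ`; inverting it gives the retarded time `τ t`, and the front is
  -- `t - τ t`.
  have hθ : ∀ s, HasDerivAt (fun s => s + lam s) (1 + lam' s) s := fun s =>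
    (hasDerivAt_id s).add (h.hasDerivAt s)
  obtain ⟨τ, hτ1, hτ2, hmono, hτc, hτ'⟩ := exists_inverse_of_one_le_deriv hθ
    (fun s => by linarith [h.nonneg s])
  have hℓ' : ∀ t, HasDerivAt (fun t => t - τ t) (1 - (1 + lam' (τ t))⁻¹) t := fun t =>
    (hasDerivAt_id t).sub (hτ' t)
  have hlam : ∀ t, t - τ t = lam (τ t) := fun t => by linarith [hτ2 t]
  have hτ0 : τ 0 = -ℓ₀ := by
    have := hτ1 (-ℓ₀)
    rwa [h.init, neg_add_cancel] at this
  refine ⟨fun t => t - τ t, contDiff_one_of_hasDerivAt hℓ' ?_, by simp [hτ0], fun t ht => ?_,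
    fun t x hx => ?_⟩
  · refine continuous_const.sub (Continuous.inv₀ (continuous_const.add
      (h.continuous_deriv.comp hτc)) fun s => ?_)
    linarith [h.nonneg (τ s)]
  · have h1 : -ℓ₀ ≤ τ t := by
      by_contra hcon
      have := hmono (not_le.1 hcon)
      simp only [hτ2, h.init] at this
      linarith [ht.1]
    have h2 := h.le h1
    rw [← hlam t] at h2
    have h3 : τ t ∈ Icc (-ℓ₀) T := ⟨h1, by linarith [ht.2]⟩
    have e : t - (t - τ t) = τ t := by ring
    simp only [e]
    refine ⟨h3, hlam t, ⟨h2, by linarith [ht.2]⟩, ?_⟩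
    have hd := hℓ' t
    rw [h.eq _ h3, ← hlam t] at hd
    refine hd.congr_deriv ?_
    have := frontRate_nonneg (p (τ t)) (k (t - τ t))
    field_simp
    ring
  · have := hτ1 (t - x)
    rw [← hx, sub_add_cancel] at this
    linarith

/-- The derivatives of a superposition of travelling waves. -/
theorem hasDerivAt_dAlembert_fst {f h : ℝ → ℝ} (hf : ContDiff ℝ 1 f) (hh : ContDiff ℝ 1 h)
    (t x : ℝ) : HasDerivAt (fun t => dAlembert f h (t, x))
      (deriv f (t - x) + deriv h (t + x)) t := by
  simp only [dAlembert]
  exact ((hasDerivAt_of_contDiff_one hf _).comp_sub_const t x).add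
    ((hasDerivAt_of_contDiff_one hh _).comp_add_const t x)

theorem hasDerivAt_dAlembert_snd {f h : ℝ → ℝ} (hf : ContDiff ℝ 1 f) (hh : ContDiff ℝ 1 h)
    (t x : ℝ) : HasDerivAt (fun x => dAlembert f h (t, x))
      (-deriv f (t - x) + deriv h (t + x)) x := by
  simp only [dAlembert]
  exact ((hasDerivAt_of_contDiff_one hf _).comp_const_sub t x).add
    ((hasDerivAt_of_contDiff_one hh _).comp_const_add t x)

theorem contDiff_dAlembert {f h : ℝ → ℝ} (hf : ContDiff ℝ 1 f) (hh : ContDiff ℝ 1 h) :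
    ContDiff ℝ 1 (dAlembert f h) :=
  (hf.comp (contDiff_fst.sub contDiff_snd)).add (hh.comp (contDiff_fst.add contDiff_snd))

/-- The profile `f` and the front `ℓ` give a `C^1` solution. -/
theorem isC1Solution_dAlembert {T ℓ₀ : ℝ} {κ y₀ y₁ u ℓ f U lam lam' k : ℝ → ℝ} (hT : 0 < T)
    (hℓ₀ : 0 < ℓ₀) (hf : ContDiff ℝ 1 f) (hU : ContDiff ℝ 1 U) (hUu : EqOn U u (Icc 0 T))
    (hκ : ∀ x, 0 ≤ x → 0 < κ x) (hkκ : EqOn k κ (Icc ℓ₀ (ℓ₀ + T)))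
    (hlam : IsFrontCurve T ℓ₀ k (deriv f) lam lam')
    (href : ∀ s ∈ Icc (-ℓ₀) T, f (s + 2 * lam s) = U (s + 2 * lam s) + f s)
    (hℓc : ContDiff ℝ 1 ℓ) (hℓ0 : ℓ 0 = ℓ₀)
    (hℓ : ∀ t ∈ Icc 0 T, t - ℓ t ∈ Icc (-ℓ₀) T ∧ ℓ t = lam (t - ℓ t) ∧ ℓ t ∈ Icc ℓ₀ (ℓ₀ + T) ∧
        HasDerivAt ℓ (frontRate (deriv f (t - ℓ t)) (k (ℓ t)) /
          (1 + frontRate (deriv f (t - ℓ t)) (k (ℓ t)))) t)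
    (hinit : ∀ x ∈ Icc 0 ℓ₀, dAlembert f (fun s => U s - f s) (0, x) = y₀ x)
    (hvel : ∀ x ∈ Icc 0 ℓ₀,
      HasDerivAt (fun t => dAlembert f (fun s => U s - f s) (t, x)) (y₁ x) 0) :
    IsC1Solution T κ ℓ₀ y₀ y₁ u ℓ (dAlembert f (fun s => U s - f s)) := by
  have hh : ContDiff ℝ 1 fun s => U s - f s := hU.sub hf
  have hYc := contDiff_dAlembert hf hh
  have hgriffith : ∀ t ∈ Icc 0 T, GriffithAt T κ ℓ (dAlembert f (fun s => U s - f s)) t := by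
    intro t ht
    obtain ⟨h1, h2, h3, h4⟩ := hℓ t ht
    set σ := t - ℓ t with hσ
    set Λ := frontRate (deriv f σ) (k (ℓ t)) with hΛdef
    have hΛ : 0 ≤ Λ := frontRate_nonneg _ _
    have hq := hasDerivAt_dAlembert_snd hf hh t (ℓ t)
    have hψ : HasDerivAt (fun s => s + 2 * lam s) (1 + 2 * Λ) σ := by
      have := (hasDerivAt_id σ).add ((hlam.hasDerivAt σ).const_mul 2)
      rwa [hlam.eq σ h1, ← h2] at this
    have hψσ : σ + 2 * lam σ = t + ℓ t := by rw [← h2, hσ]; ring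
    -- This differentiates the reflection law, within `[-ℓ₀, T]` because it is known only there. It
    -- supplies the strain relation needed for Griffith's criterion.
    have hder : -deriv (fun s => U s - f s) (t + ℓ t) * (1 + 2 * Λ) = deriv f σ := by
      have e1 : HasDerivAt (fun s => -(U (s + 2 * lam s) - f (s + 2 * lam s)))
          (-(deriv (fun s => U s - f s) (t + ℓ t) * (1 + 2 * Λ))) σ :=
        (HasDerivAt.comp (h₂ := fun s => U s - f s) σ
          (by rw [hψσ]; exact hasDerivAt_of_contDiff_one hh _) hψ).neg
      have e2 := (hasDerivAt_of_contDiff_one hf σ).hasDerivWithinAt (s := Icc (-ℓ₀) T)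
      have e3 := e2.congr (f₁ := fun s => -(U (s + 2 * lam s) - f (s + 2 * lam s)))
        (fun s hs => by linarith [href s hs]) (by linarith [href σ h1])
      have := (uniqueDiffOn_Icc (show -ℓ₀ < T by linarith) σ h1).eq_deriv _ e1.hasDerivWithinAt e3
      rw [neg_mul]
      exact this
    have hκk : κ (ℓ t) = k (ℓ t) := (hkκ h3).symm
    have hpos : 0 < ℓ t := hℓ₀.trans_le h3.1
    obtain ⟨g1, g2, g3⟩ := griffith_of_eq_frontRate_div (p := deriv f σ) (k := κ (ℓ t))
      (v := Λ / (1 + Λ)) (q := -deriv f σ + deriv (fun s => U s - f s) (t + ℓ t))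
      (hκ _ hpos.le) (by rw [hκk]) (by
        have : 1 + Λ ≠ 0 := by linarith
        field_simp
        linear_combination (-1) * hder)
    exact ⟨_, _, h4.hasDerivWithinAt, hq.hasDerivWithinAt, g1, g2, g3⟩
  refine
    { lipschitz_front := hℓc.contDiffOn.exists_lipschitzOnWith one_ne_zero (convex_Icc _ _)
        isCompact_Icc
      lipschitz_displacement := ?_
      wave := weakWave_dAlembert hf.continuous hh.continuous T ℓ
      left_boundary := fun t ht => by simp [dAlembert, hUu ht]
      front_boundary := fun t ht => ?_
      initial_displacement := hinit
      initial_velocity_ae := ?_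
      initial_front := hℓ0
      griffith_ae := ?_
      contDiff_front := hℓc.contDiffOn
      contDiff_displacement := hYc.contDiffOn
      initial_velocity := fun x hx => (hvel x hx).hasDerivWithinAt
      griffith := fun t ht => hgriffith t (Ioc_subset_Icc_self ht) }
  -- The domain need not be convex, so the Lipschitz bound is taken on a compact rectangle
  -- containing it.
  · obtain ⟨K, hK⟩ := (hYc.contDiffOn (s := Icc 0 T ×ˢ Icc 0 (ℓ₀ + T))).exists_lipschitzOnWith
      one_ne_zero ((convex_Icc _ _).prod (convex_Icc _ _)) (isCompact_Icc.prod isCompact_Icc)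
    refine ⟨K, hK.mono fun p hp => ⟨⟨hp.1, hp.2.1⟩, hp.2.2.1, ?_⟩⟩
    exact hp.2.2.2.trans (hℓ p.1 ⟨hp.1, hp.2.1⟩).2.2.1.2
  · obtain ⟨h1, h2, -, -⟩ := hℓ t ht
    have := href _ h1
    rw [← h2, show t - ℓ t + 2 * ℓ t = t + ℓ t by ring] at this
    simp only [dAlembert]
    linarith
  · rw [ae_restrict_iff' measurableSet_Icc]
    exact Filter.Eventually.of_forall fun x hx => (hvel x hx).hasDerivWithinAt
  · rw [ae_restrict_iff' measurableSet_Icc]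
    exact Filter.Eventually.of_forall hgriffith

end Debonding

/-! ### Assembly -/

theorem mainTheorem7 (T ℓ₀ c₁ c₂ : ℝ) (κ y₀ y₁ u : ℝ → ℝ)
    (hT : 0 < T) (hℓ₀ : 0 < ℓ₀)
    (hc₁ : 0 < c₁) (hc₁₂ : c₁ < c₂)
    (hκ : ∀ x, 0 ≤ x → κ x ∈ Set.Icc c₁ c₂)
    (hκLip : LocallyLipschitzOn (Set.Ici 0) κ)
    (hy₀ : ContDiffOn ℝ 1 y₀ (Set.Icc 0 ℓ₀))
    (hy₁ : ContinuousOn y₁ (Set.Icc 0 ℓ₀))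
    (hu : ContDiffOn ℝ 1 u (Set.Icc 0 T))
    (hcompat₀ : y₀ 0 = u 0)
    (hcompatℓ : y₀ ℓ₀ = 0)
    (hcompat₀' : y₁ 0 = derivWithin u (Set.Icc 0 T) 0)
    (hcompatℓ' : y₁ ℓ₀ =
      -Debonding.frontSpeed (y₁ ℓ₀ - derivWithin y₀ (Set.Icc 0 ℓ₀) ℓ₀) (κ ℓ₀) *
        derivWithin y₀ (Set.Icc 0 ℓ₀) ℓ₀) :
    ∃ (ℓ : ℝ → ℝ) (y : ℝ × ℝ → ℝ),
      Debonding.IsC1Solution T κ ℓ₀ y₀ y₁ u ℓ y ∧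
      (∃ f : ℝ → ℝ, Debonding.IsRepresentative T ℓ₀ y₀ y₁ u ℓ f ∧
        ContDiffOn ℝ 1 f (Set.Icc (-ℓ₀) T) ∧
        ∀ g : ℝ → ℝ, Debonding.IsRepresentative T ℓ₀ y₀ y₁ u ℓ g →
          Set.EqOn g f (Set.Icc (-ℓ₀) T)) ∧
      (∀ (m : ℝ → ℝ) (z : ℝ × ℝ → ℝ), Debonding.IsLipschitzSolution T κ ℓ₀ y₀ y₁ u m z →
        Set.EqOn m ℓ (Set.Icc 0 T) ∧ Set.EqOn z y (Debonding.domain T ℓ)) := by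
  open Debonding in
  have hκ0 : ∀ x, 0 ≤ x → 0 < κ x := fun x hx => hc₁.trans_le (hκ x hx).1
  have m0 : (0 : ℝ) ∈ Icc 0 ℓ₀ := ⟨le_rfl, hℓ₀.le⟩
  have mℓ : ℓ₀ ∈ Icc 0 ℓ₀ := ⟨hℓ₀.le, le_rfl⟩
  obtain ⟨U, hU, hUu⟩ := exists_contDiff_extension hT hu
  obtain ⟨Y₀, hY₀, hYy⟩ := exists_contDiff_extension hℓ₀ hy₀
  obtain ⟨E, hE, hEy⟩ := exists_continuous_extension hℓ₀.le hy₁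
  -- A front of speed at most one stays in `[ℓ₀, ℓ₀ + T]`, so freezing the toughness outside changes
  -- nothing.
  obtain ⟨k, L, hk, hck, hkκ⟩ := exists_lipschitz_toughness hℓ₀.le
    (show ℓ₀ ≤ ℓ₀ + T by linarith) hκ hκLip
  have hD := continuous_deriv_of_contDiff_one hY₀
  have hDy : ∀ x ∈ Icc 0 ℓ₀, derivWithin y₀ (Icc 0 ℓ₀) x = deriv Y₀ x := fun x hx =>
    deriv_eq_derivWithin_of_eqOn hℓ₀ hY₀ hYy hx
  have hU0 : U 0 = u 0 := hUu ⟨le_rfl, hT.le⟩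
  have hintD : ∀ x, ∫ σ in (0 : ℝ)..x, deriv Y₀ σ = Y₀ x - Y₀ 0 := fun x =>
    intervalIntegral.integral_eq_sub_of_hasDerivAt
      (fun s _ => hasDerivAt_of_contDiff_one hY₀ s) (hD.intervalIntegrable _ _)
  obtain ⟨f₀, hf₀, hfl, hfr, hdl, hdr, h0, h1⟩ := exists_initial_profile (k₀ := k ℓ₀) hℓ₀
    (hc₁.trans_le (hck _)) hD hE hU
    (by rw [hEy m0, hcompat₀', deriv_eq_derivWithin_of_eqOn hT hU hUu ⟨le_rfl, hT.le⟩])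
    (by rw [hintD, hYy m0, hYy mℓ, hcompatℓ, hcompat₀, hU0, zero_sub])
    (by rw [hEy mℓ, ← hDy _ mℓ, hkκ ⟨le_rfl, by linarith⟩]; exact hcompatℓ')
  obtain ⟨f, lam, lam', hf, hff₀, hlam, href⟩ := exists_profile_frontCurve (T := T) hℓ₀
    (by linarith) hc₁ hk hck hU hf₀ h0 h1
  obtain ⟨ℓ, hℓc, hℓ0, hℓ, hℓu⟩ := hlam.exists_front hℓ₀
  have hh : ContDiff ℝ 1 fun s => U s - f s := hU.sub hf
  have hdf : ∀ s ≤ ℓ₀, deriv f s = deriv f₀ s := fun s hs =>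
    deriv_eq_of_eqOn hf hf₀ (uniqueDiffOn_Iic ℓ₀) hff₀ hs
  have hinit : ∀ x ∈ Icc 0 ℓ₀, dAlembert f (fun s => U s - f s) (0, x) = y₀ x := by
    intro x hx
    simp only [dAlembert, zero_sub, zero_add]
    rw [hff₀ hx.2, hff₀ (show -x ≤ ℓ₀ by linarith [hx.1]), hfl (-x) (by linarith [hx.1]),
      hfr x hx.1, neg_neg, intervalIntegral.integral_sub (hD.intervalIntegrable _ _)
        (hE.intervalIntegrable _ _), intervalIntegral.integral_add (hD.intervalIntegrable _ _)
        (hE.intervalIntegrable _ _), hintD, hYy hx, hYy m0, hcompat₀, hU0]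
    ring
  have hvel : ∀ x ∈ Icc 0 ℓ₀,
      HasDerivAt (fun t => dAlembert f (fun s => U s - f s) (t, x)) (y₁ x) 0 := by
    intro x hx
    refine (hasDerivAt_dAlembert_fst hf hh 0 x).congr_deriv ?_
    rw [zero_sub, zero_add, deriv_fun_sub (hU.differentiable one_ne_zero x)
      (hf.differentiable one_ne_zero x), hdf x hx.2, hdf (-x) (by linarith [hx.1]),
      hdl (-x) (by linarith [hx.1]), hdr x hx.1, neg_neg, hEy hx]
    ring
  have hsol := isC1Solution_dAlembert (u := u) (κ := κ) hT hℓ₀ hf hU hUu hκ0 hkκ hlam href hℓc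
    hℓ0 hℓ hinit hvel
  have hslow := hsol.toIsLipschitzSolution.isSlowFront hℓ₀ hκ0
  have hcongr : ∀ s ∈ Icc 0 ℓ₀, ∀ σ ∈ uIcc 0 s, σ ∈ Icc 0 ℓ₀ := fun s hs σ hσ => by
    rw [uIcc_of_le hs.1] at hσ
    exact ⟨hσ.1, hσ.2.trans hs.2⟩
  have hrep : IsRepresentative T ℓ₀ y₀ y₁ u ℓ f :=
    { initial := fun s hs => by
        rw [hff₀ (show s ≤ ℓ₀ by linarith [hs.2]), hfl s hs.2]
        congr 1
        refine intervalIntegral.integral_congr fun σ hσ => ?_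
        have := hcongr (-s) ⟨by linarith [hs.2], by linarith [hs.1]⟩ σ hσ
        simp only [hDy σ this, hEy this]
      control := fun s hs hsT => by
        rw [hff₀ hs.2, hfr s hs.1.le, hUu ⟨hs.1.le, hsT⟩, hU0]
        congr 2
        refine intervalIntegral.integral_congr fun σ hσ => ?_
        have := hcongr s ⟨hs.1.le, hs.2⟩ σ hσ
        simp only [hDy σ this, hEy this]
      reflection := fun t ht htℓ htT => by
        obtain ⟨g1, g2, g3, -⟩ := hℓ t ⟨ht.le, htT⟩
        have := href _ g1
        rw [← g2, show t - ℓ t + 2 * ℓ t = t + ℓ t by ring,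
          hUu ⟨by linarith [g3.1], htℓ⟩] at this
        exact this }
  refine ⟨ℓ, dAlembert f (fun s => U s - f s), hsol, ⟨f, hrep, hf.contDiffOn, fun g hg =>
    hrep.eqOn hℓ₀ hslow hℓ0 hg⟩, fun m z hmz => ?_⟩
  have hm := hmz.isSlowFront hℓ₀ hκ0
  obtain ⟨K, hK⟩ := hmz.lipschitz_displacement
  have hvel' := hmz.initial_velocity_ae
  have hG := hmz.griffith_ae
  rw [ae_restrict_iff' measurableSet_Icc] at hvel' hG
  have hleft : ∀ t ∈ Icc 0 T, z (t, 0) = U t := fun t ht => by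
    rw [hmz.left_boundary t ht, hUu ht]
  have hbase := eq_dAlembert_of_initial hm hmz.wave hK hmz.initial_front hℓ₀ hf hU hleft
    (fun x hx => by rw [hmz.initial_displacement x hx, hinit x hx]) hvel' hvel
  obtain ⟨hfront, hdisp⟩ := front_and_displacement_unique hm hmz.wave hK hmz.initial_front hℓ₀
    hmz.front_boundary hleft hf hbase hc₁ hκ0 hk hck hkκ hlam href hG
  -- The equation `x = lam (t - x)` has only one solution `x` for each `t`.
  have hmℓ : EqOn m ℓ (Icc 0 T) := fun t ht => hℓu t (m t) (hfront t ht)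
  refine ⟨hmℓ, fun p hp => hdisp p ⟨hp.1, hp.2.1, hp.2.2.1, ?_⟩⟩
  rw [hmℓ ⟨hp.1, hp.2.1⟩]
  exact hp.2.2.2
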